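/- **Setting.** Let $X$ (women) and $Y$ (men) be finite sets with $|X|=|Y|=n\ge 1$. Each player holds a strict linear order (preference list) on a subset of the players of the opposite sex, and preferences are symmetric: $m$ is on $w$'s list if and only if $w$ is on $m$'s list. Let $E$ be the set of pairs $(m,w)\in Y\times X$ that rank one another. A matching is a set $M\subseteq E$ in which no two edges share a player. An edge $(m,w)\in E\setminus M$ is a blocking pair for $M$ if $m$ and $w$ each prefer the other to their partner in $M$ (an unmatched player prefers every acceptable partner to having none). $M$ is $(1-\varepsilon)$-stable if it has at most $\varepsilon|E|$ blocking pairs. **Model (CONGEST).** Each player is a processor with a unique id. Initially it knows $n,\varepsilon,\delta$, its own id and gender, and its preference list (as a list of ids). The communication links are the edges in $E$. In each synchronous round every processor receives the messages sent to it in the previous round, draws private randomness (independent over processors and rounds), performs an arbitrary local computation, and sends to each neighbour a (possibly different) message of $O(\log n)$ bits, or none. At the end every processor outputs its partner, or that it has none. **Theorem.** There is a randomized distributed algorithm RandASM in this model, with parameters $n,\varepsilon,\delta$, and there are absolute constants $B, C$ such that for all $n\ge 1$, all $\varepsilon,\delta>0$ and all preferences as above (with any assignment of distinct natural-number ids), RandASM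 runs for at most $$C\,\varepsilon^{-3}\log^2\!\left(\frac{n}{\delta\varepsilon^{3}}\right)$$ rounds, sends only messages of at most $B\log n$ bits, and with probability at least $1-\delta$ the outputs of the players form a $(1-\varepsilon)$-stable matching. -/

import Mathlib

namespace AlmostStable

/-! ### Preferences, matchings and almost stability -/

/-- Preferences of the women `X` and the men `Y`: every player holds a duplicate-free list of
members of the opposite sex (a linear order on its acceptable partners), most preferred first.
Preferences are symmetric: a man is acceptable to a woman iff she is acceptable to him. -/
structure Preferences (X Y : Type) where
  woman : X → List Y
  man : Y → List X
  woman_nodup : ∀ x, (woman x).Nodup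
  man_nodup : ∀ y, (man y).Nodup
  symm : ∀ x y, y ∈ woman x ↔ x ∈ man y

/-- `a` precedes `b` on the list `l`. -/
def Precedes {α : Type} (l : List α) (a b : α) : Prop :=
  ∃ i j : ℕ, i < j ∧ l[i]? = some a ∧ l[j]? = some b

namespace Preferences

variable {X Y : Type} (P : Preferences X Y)

/-- The pairs (man, woman) who rank one another. -/
def edges : Set (Y × X) := {e | e.1 ∈ P.woman e.2 ∧ e.2 ∈ P.man e.1}

/-- The communication graph on all players. -/
def commGraph : SimpleGraph (X ⊕ Y) :=
  SimpleGraph.fromRel fun u v => ∃ x y, u = Sum.inl x ∧ v = Sum.inr y ∧ (y, x) ∈ P.edges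

/-- A matching: a set of edges, no two of which share a player. -/
def IsMatching (M : Set (Y × X)) : Prop :=
  M ⊆ P.edges ∧ ∀ e ∈ M, ∀ f ∈ M, (e.1 = f.1 ∨ e.2 = f.2) → e = f

/-- The blocking pairs of `M`: edges outside `M` whose two players each prefer the other to
their partner in `M`. An unmatched player prefers every acceptable partner to being single. -/
def blockingPairs (M : Set (Y × X)) : Set (Y × X) :=
  {e | e ∈ P.edges ∧ e ∉ M ∧
    (∀ y, (y, e.2) ∈ M → Precedes (P.woman e.2) e.1 y) ∧
    (∀ x, (e.1, x) ∈ M → Precedes (P.man e.1) e.2 x)}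

/-- `M` is a `(1 - ε)`-stable matching: it induces at most `ε |E|` blocking pairs. -/
def IsAlmostStable (ε : ℝ) (M : Set (Y × X)) : Prop :=
  P.IsMatching M ∧ ((P.blockingPairs M).ncard : ℝ) ≤ ε * (P.edges.ncard : ℝ)

end Preferences

/-! ### Randomized synchronous message passing -/

/-- A message is a string of bits. -/
abbrev Message := List Bool

/-- A randomized synchronous message-passing algorithm, executed by every processor, with local
inputs in `I` and local outputs in `O`. It runs for a fixed number of rounds. In one round a
processor takes its state, the set of pairs (sender's id, message) that it receives, and a
private random element drawn uniformly from the finite set `Coin`; it computes, without any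
restriction, a new state and for each id the message (if any) for the neighbour with that id. -/
structure DistributedAlgorithm (I O : Type) where
  State : Type
  Coin : Type
  [fintypeCoin : Fintype Coin]
  [nonemptyCoin : Nonempty Coin]
  rounds : ℕ
  init : I → State
  step : State → Set (ℕ × Message) → Coin → State × (ℕ → Option Message)
  output : State → O

attribute [instance] DistributedAlgorithm.fintypeCoin DistributedAlgorithm.nonemptyCoin

namespace DistributedAlgorithm

variable {I O V : Type} (A : DistributedAlgorithm I O)
  (G : SimpleGraph V) (uid : V → ℕ) (input : V → I)

/-- A global configuration: the state of each processor, and the messages it has just sent. -/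
abbrev Config (V : Type) := V → A.State × (ℕ → Option Message)

/-- Before the first round no message has been sent. -/
def initConfig : A.Config V := fun v => (A.init (input v), fun _ => none)

/-- What `v` receives: the messages addressed to it by its neighbours in `G`, with sender ids. -/
def inbox (c : A.Config V) (v : V) : Set (ℕ × Message) :=
  {p | ∃ u, G.Adj u v ∧ p.1 = uid u ∧ (c u).2 (uid v) = some p.2}

/-- One synchronous round, in which processor `v` has drawn `r v`. -/
def round (c : A.Config V) (r : V → A.Coin) : A.Config V :=
  fun v => A.step (c v).1 (A.inbox G uid c v) (r v)

/-- The law of the configuration after `t` rounds. The random elements are independent over all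
processors and rounds. -/
noncomputable def law [Fintype V] [DecidableEq V] : ℕ → PMF (A.Config V)
  | 0 => PMF.pure (A.initConfig input)
  | t + 1 => (law t).bind fun c =>
      (PMF.uniformOfFintype (V → A.Coin)).map fun r => A.round G uid c r

/-- In every possible execution, every message sent to a neighbour has at most `b` bits. -/
def MessagesAtMost [Fintype V] [DecidableEq V] (b : ℝ) : Prop :=
  ∀ t ≤ A.rounds, ∀ c ∈ (A.law G uid input t).support, ∀ u v, G.Adj u v →
    ∀ m, (c u).2 (uid v) = some m → (m.length : ℝ) ≤ b

/-- The law of the family of local outputs. -/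
noncomputable def outputLaw [Fintype V] [DecidableEq V] : PMF (V → O) :=
  (A.law G uid input A.rounds).map fun c v => A.output (c v).1

end DistributedAlgorithm

/-! ### The almost stable matching problem as a distributed problem -/

inductive Gender
  | female
  | male

/-- What a player knows initially, besides the global parameters: its gender, its own id, and
the ids of its acceptable partners, most preferred first. -/
structure PlayerInput where
  gender : Gender
  id : ℕ
  prefs : List ℕ

namespace Preferences

variable {X Y : Type} (P : Preferences X Y) (uid : X ⊕ Y → ℕ)

def playerInput : X ⊕ Y → PlayerInput
  | Sum.inl x => ⟨Gender.female, uid (Sum.inl x), (P.woman x).map fun y => uid (Sum.inr y)⟩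
  | Sum.inr y => ⟨Gender.male, uid (Sum.inr y), (P.man y).map fun x => uid (Sum.inl x)⟩

end Preferences

/-- The outputs of the players represent `M`: every player matched in `M` outputs the id of its
partner, and every player unmatched in `M` outputs `none`. -/
def Represents {X Y : Type} (uid : X ⊕ Y → ℕ) (out : X ⊕ Y → Option ℕ) (M : Set (Y × X)) :
    Prop :=
  (∀ x i, out (Sum.inl x) = some i ↔ ∃ y, (y, x) ∈ M ∧ uid (Sum.inr y) = i) ∧
  (∀ y i, out (Sum.inr y) = some i ↔ ∃ x, (y, x) ∈ M ∧ uid (Sum.inl x) = i)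

end AlmostStable

/-!
The dynamics behind the algorithm has a very small state, the assignment `p : X → Option Y` of
partners to the women. Every preference list is cut into `k ≈ 4 / ε` quantiles (`quantile`). A
woman accepts single men only from quantiles strictly better than that of her partner (`Live`). In
a step, each single man of sufficiently high degree proposes to a uniformly random woman among
those who still accept him in the best quantile with such a woman, and each woman takes her best
proposer (`Preferences.next`). Men learn what they need from the women's announcements, so one
step costs two rounds and messages of at most one bit (`randASM`, `Preferences.outputLaw_randASM`).

A matched man has been rejected by all women of better quantiles (`Preferences.Valid`). Hence a
blocking pair either involves an *unsettled* man, who is single although some woman still accepts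
him, or a player matched to a member of the quantile of the other one; the latter pairs are at
most `2 |E| / k` (`Preferences.Valid.ncard_blockingPairs_le`). It remains to make the unsettled men
few. This is done for the degree classes `2 ^ i ≤ degree`, one after the other: a fraction of at
most `ε / 4` in every class leaves at most `(ε / 2) |E|` edges at unsettled men
(`Preferences.sum_length_unsettled_le`), and later stages do not spoil earlier ones
(`Preferences.Valid.card_unsettled_next_le`).

Progress in a stage is measured by two quantities. Each woman who receives a proposal moves to a
better quantile, which happens at most `k` times for each man of the class. Each man sees the
women of his quantiles disappear, which is measured by the logarithm of their number. If no
better-liked man proposes to `w`, then redrawing the choice of `m` alone makes her take `m` with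
probability one over the number `d` of his choices; so the chance that the pair survives is at
most `2 d` times the chance that it gets matched (`Preferences.card_live_next_le`). Summing over all
pairs, the expected progress is at least half the number of unsettled men
(`Preferences.le_sum_progress`). Therefore the exponential of the normalized potential shrinks by
a factor `1 - ε / 32` in expectation while more than a fraction `ε / 4` of the class is unsettled
(`Preferences.Valid.sum_potential_next_le`), and a stage of `O(ε⁻² log (n / δ))` steps fails with
probability at most `δ / n` (`Preferences.chain_crowded_le`). There are `O(log n)` stages.

If `ε ≥ 1` or `δ ≥ 1`, or if `n = 1`, no communication is needed. This case matters because the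
bound on the number of rounds may vanish.
-/

namespace AlmostStable

open Finset

/-! ### Quantiles of preference lists -/

section Lists

variable {α β : Type} [DecidableEq α] [DecidableEq β]

/-- The index of the quantile of `l` that holds `a`, when `l` is cut into at most `k` blocks of
`(l.length - 1) / k + 1` consecutive entries. -/
def quantile (k : ℕ) (l : List α) (a : α) : ℕ := l.idxOf a / ((l.length - 1) / k + 1)

/-- A player with preference list `l` and current partner `cur` still accepts `a`: it is single,
or `a` is its partner, or `a` lies in a strictly better quantile than its partner. -/
def Acceptable (k : ℕ) (l : List α) (cur : Option α) (a : α) : Prop :=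
  ∀ b, cur = some b → a = b ∨ quantile k l a < quantile k l b

open Classical in
/-- The entries of `l` that satisfy `live` and lie in the best quantile with such an entry. -/
noncomputable def candidates (k : ℕ) (l : List α) (live : α → Prop) : List α :=
  l.filter fun a => live a ∧ ∀ b ∈ l, live b → quantile k l a ≤ quantile k l b

theorem quantile_lt {k : ℕ} (hk : 0 < k) {l : List α} {a : α} (ha : a ∈ l) :
    quantile k l a < k := by
  have h1 : l.idxOf a < l.length := List.idxOf_lt_length_of_mem ha
  have h2 := Nat.lt_mul_div_succ (l.length - 1) hk
  unfold quantile
  rw [Nat.div_lt_iff_lt_mul (Nat.succ_pos _)]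
  exact (Nat.le_sub_one_of_lt h1).trans_lt h2

/-- A quantile has at most `l.length / k` entries besides any given one. -/
theorem card_quantile_eq_le {k : ℕ} {l : List α} {a : α} (ha : a ∈ l) :
    (((l.toFinset.filter fun b => quantile k l b = quantile k l a).erase a).card : ℝ)
      ≤ l.length / k := by
  set s := (l.length - 1) / k + 1 with hs
  have hcard : (l.toFinset.filter fun b => quantile k l b = quantile k l a).card ≤ s := by
    have : ((l.toFinset.filter fun b => quantile k l b = quantile k l a).image
        fun b => l.idxOf b) ⊆ Finset.Ico (s * quantile k l a) (s * quantile k l a + s) := by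
      intro i hi
      simp only [Finset.mem_image, Finset.mem_filter, List.mem_toFinset] at hi
      obtain ⟨b, ⟨-, hb⟩, rfl⟩ := hi
      rw [← hb, Finset.mem_Ico]
      have := Nat.div_add_mod (l.idxOf b) s
      have := Nat.mod_lt (l.idxOf b) (show 0 < s from Nat.succ_pos _)
      unfold quantile
      rw [← hs]
      omega
    have h := Finset.card_le_card this
    rw [Finset.card_image_of_injOn] at h
    · simpa using h
    · intro b hb c hc hbc
      simp only [Finset.coe_filter, List.mem_toFinset, Set.mem_ofPred_eq] at hb
      exact (List.idxOf_inj hb.1).1 hbc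
  rw [Finset.card_erase_of_mem (by simp [ha])]
  have h2 : (l.toFinset.filter fun b => quantile k l b = quantile k l a).card - 1 ≤
      l.length / k := by
    exact (Nat.sub_le_sub_right hcard 1).trans
      (by rw [hs, Nat.add_sub_cancel]; exact Nat.div_le_div_right (Nat.sub_le _ _))
  exact (Nat.cast_le.2 h2).trans Nat.cast_div_le

theorem mem_candidates {k : ℕ} {l : List α} {live : α → Prop} {a : α} :
    a ∈ candidates k l live ↔
      a ∈ l ∧ live a ∧ ∀ b ∈ l, live b → quantile k l a ≤ quantile k l b := by
  simp [candidates]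

theorem candidates_ne_nil {k : ℕ} {l : List α} {live : α → Prop} {a : α} (ha : a ∈ l)
    (hl : live a) : candidates k l live ≠ [] := by
  classical
  obtain ⟨b, hb, hmin⟩ := Finset.exists_min_image (l.toFinset.filter live) (quantile k l)
    ⟨a, by simp [ha, hl]⟩
  simp only [Finset.mem_filter, List.mem_toFinset] at hb hmin
  exact List.ne_nil_of_mem (mem_candidates.2 ⟨hb.1, hb.2, fun c hc hlc => hmin c ⟨hc, hlc⟩⟩)

theorem candidates_nodup {k : ℕ} {l : List α} {live : α → Prop} (h : l.Nodup) :
    (candidates k l live).Nodup := h.filter _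

section Map

variable {f : α → β} (hf : Function.Injective f)

include hf

theorem idxOf_map_of_injective (l : List α) (a : α) : (l.map f).idxOf (f a) = l.idxOf a := by
  induction l with
  | nil => rfl
  | cons b l ih => simp [List.idxOf_cons, ih, hf.beq_eq]

theorem quantile_map (k : ℕ) (l : List α) (a : α) :
    quantile k (l.map f) (f a) = quantile k l a := by
  simp [quantile, idxOf_map_of_injective hf]

theorem acceptable_map (k : ℕ) (l : List α) (cur : Option α) (a : α) :
    Acceptable k (l.map f) (cur.map f) (f a) ↔ Acceptable k l cur a := by
  simp only [Acceptable, Option.map_eq_some_iff]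
  constructor
  · intro h b hb
    have := h (f b) ⟨b, hb, rfl⟩
    rwa [hf.eq_iff, quantile_map hf, quantile_map hf] at this
  · rintro h _ ⟨b, hb, rfl⟩
    rw [hf.eq_iff, quantile_map hf, quantile_map hf]
    exact h b hb

theorem candidates_map (k : ℕ) (l : List α) (live : β → Prop) :
    candidates k (l.map f) live = (candidates k l fun a => live (f a)).map f := by
  simp only [candidates, List.filter_map]
  congr 1
  apply List.filter_congr
  intro a _
  simp [quantile_map hf]

end Map

/-- `find?` returns the entry of least index among those that satisfy the predicate. -/
theorem find?_eq_some_iff_idxOf {l : List α} {q : α → Bool} {a : α} :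
    l.find? q = some a ↔ q a = true ∧ a ∈ l ∧ ∀ b ∈ l, q b = true → l.idxOf a ≤ l.idxOf b := by
  induction l with
  | nil => simp
  | cons c l ih =>
    rw [List.find?_cons]
    cases hc : q c with
    | true =>
      simp only [Option.some.injEq, List.mem_cons]
      constructor
      · rintro rfl
        simp [hc]
      · rintro ⟨h1, h2, h3⟩
        have := h3 c (Or.inl rfl) hc
        rw [List.idxOf_cons_self, Nat.le_zero, List.idxOf_cons] at this
        by_contra hne
        simp [beq_eq_false_iff_ne.2 hne] at this
    | false =>
      simp only [ih, List.mem_cons]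
      have key : ∀ b, q b = true → List.idxOf b (c :: l) = List.idxOf b l + 1 := by
        intro b hb
        have hne : c ≠ b := by
          rintro rfl
          simp [hc] at hb
        simp [List.idxOf_cons, beq_eq_false_iff_ne.2 hne]
      constructor
      · rintro ⟨h1, h2, h3⟩
        refine ⟨h1, Or.inr h2, ?_⟩
        rintro b hb hqb
        rw [key a h1, key b hqb]
        rcases hb with rfl | hb
        · simp [hc] at hqb
        · exact Nat.succ_le_succ (h3 b hb hqb)
      · rintro ⟨h1, h2, h3⟩
        refine ⟨h1, ?_, ?_⟩
        · rcases h2 with rfl | h2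
          · simp [hc] at h1
          · exact h2
        · intro b hb hqb
          have := h3 b (Or.inr hb) hqb
          rw [key a h1, key b hqb] at this
          omega

end Lists

/-! ### One step of the proposal dynamics -/

namespace Preferences

variable {X Y : Type} [DecidableEq X] [DecidableEq Y] (P : Preferences X Y) (k : ℕ)

/-- Woman `w` has not rejected man `m`, when `p` assigns the current partners of the women. -/
def Live (p : X → Option Y) (m : Y) (w : X) : Prop := Acceptable k (P.woman w) (p w) m

open Classical in
/-- The proposal of man `m` with random number `c`: if he is single and has at least `θ`
acceptable partners, a random woman of his best quantile with a woman who has not rejected him. -/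
noncomputable def proposal (θ : ℕ) (p : X → Option Y) (c : ℕ) (m : Y) : Option X :=
  let A := candidates k (P.man m) (P.Live k p m)
  if (∀ w, p w ≠ some m) ∧ θ ≤ (P.man m).length then A[c % A.length]? else none

open Classical in
/-- One step: each woman who receives proposals takes the best proposer. -/
noncomputable def next (θ : ℕ) (p : X → Option Y) (r : Y → ℕ) : X → Option Y := fun w =>
  ((P.woman w).find? fun m => P.proposal k θ p (r m) m = some w).or (p w)

/-- The invariant of the dynamics: the partners form a matching, and a matched man has been
rejected by all women in quantiles better than that of his partner. -/
structure Valid (p : X → Option Y) : Prop where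
  mem : ∀ w m, p w = some m → m ∈ P.woman w
  inj : ∀ w w' m, p w = some m → p w' = some m → w = w'
  cleared : ∀ w m, p w = some m → ∀ w' ∈ P.man m,
    quantile k (P.man m) w' < quantile k (P.man m) w → ¬ P.Live k p m w'

variable {P k} {θ : ℕ} {p : X → Option Y} {r : Y → ℕ}

theorem proposal_eq_some {c : ℕ} {m : Y} {w : X} (h : P.proposal k θ p c m = some w) :
    (∀ w, p w ≠ some m) ∧ θ ≤ (P.man m).length ∧
      w ∈ candidates k (P.man m) (P.Live k p m) := by
  unfold proposal at h
  simp only at h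
  split_ifs at h with h1
  exact ⟨h1.1, h1.2, List.mem_of_getElem? h⟩

/-- A proposer lies in a strictly better quantile than the current partner. -/
theorem quantile_lt_of_proposal {c : ℕ} {m m' : Y} {w : X}
    (h : P.proposal k θ p c m = some w) (hp : p w = some m') :
    quantile k (P.woman w) m < quantile k (P.woman w) m' := by
  obtain ⟨h1, -, h3⟩ := proposal_eq_some h
  rcases (mem_candidates.1 h3).2.1 m' hp with rfl | h
  · exact absurd hp (h1 w)
  · exact h

theorem next_eq_some_iff {w : X} {m : Y} :
    P.next k θ p r w = some m ↔
      (P.proposal k θ p (r m) m = some w ∧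
        ∀ m', P.proposal k θ p (r m') m' = some w →
          (P.woman w).idxOf m ≤ (P.woman w).idxOf m') ∨
      ((∀ m', P.proposal k θ p (r m') m' ≠ some w) ∧ p w = some m) := by
  have hmem : ∀ m, P.proposal k θ p (r m) m = some w → m ∈ P.woman w := fun m hm =>
    (P.symm w m).2 (mem_candidates.1 (proposal_eq_some hm).2.2).1
  unfold next
  rw [Option.or_eq_some_iff, find?_eq_some_iff_idxOf, List.find?_eq_none]
  simp only [decide_eq_true_eq]
  constructor
  · rintro (⟨h1, h2, h3⟩ | ⟨h1, h2⟩)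
    · exact Or.inl ⟨h1, fun m' hm' => h3 m' (hmem m' hm') hm'⟩
    · exact Or.inr ⟨fun m' hm' => h1 m' (hmem m' hm') hm', h2⟩
  · rintro (⟨h1, h2⟩ | ⟨h1, h2⟩)
    · exact Or.inl ⟨h1, hmem m h1, fun m' _ hm' => h2 m' hm'⟩
    · exact Or.inr ⟨fun m' _ => h1 m', h2⟩

theorem next_of_proposal {w : X} {m : Y} (h : P.proposal k θ p (r m) m = some w) :
    ∃ m', P.next k θ p r w = some m' ∧ P.proposal k θ p (r m') m' = some w ∧
      (P.woman w).idxOf m' ≤ (P.woman w).idxOf m := by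
  have hmem : m ∈ P.woman w :=
    (P.symm w m).2 (mem_candidates.1 (proposal_eq_some h).2.2).1
  cases hf : P.next k θ p r w with
  | none =>
    unfold next at hf
    rw [Option.or_eq_none_iff, List.find?_eq_none] at hf
    exact absurd (by simpa using h) (hf.1 m hmem)
  | some m' =>
    rcases next_eq_some_iff.1 hf with ⟨h1, h2⟩ | ⟨h1, -⟩
    · exact ⟨m', rfl, h1, h2 m h⟩
    · exact absurd h (h1 m)

theorem next_of_no_proposal {w : X} (h : ∀ m, P.proposal k θ p (r m) m ≠ some w) :
    P.next k θ p r w = p w := by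
  ext m
  rw [next_eq_some_iff]
  constructor
  · rintro (⟨h1, -⟩ | ⟨-, h2⟩)
    · exact absurd h1 (h m)
    · exact h2
  · exact fun h2 => Or.inr ⟨h, h2⟩

theorem quantile_le_of_idxOf_le {α : Type} [DecidableEq α] {k : ℕ} {l : List α} {a b : α}
    (h : l.idxOf a ≤ l.idxOf b) : quantile k l a ≤ quantile k l b :=
  Nat.div_le_div_right h

/-- Rejections are never withdrawn. -/
theorem live_of_live_next {m : Y} {w : X} (h : P.Live k (P.next k θ p r) m w) :
    P.Live k p m w := by
  intro m₀ hm₀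
  by_cases hprop : ∃ m₁, P.proposal k θ p (r m₁) m₁ = some w
  · obtain ⟨m₁, hm₁⟩ := hprop
    obtain ⟨m₂, h1, h2, -⟩ := next_of_proposal hm₁
    have h3 := quantile_lt_of_proposal h2 hm₀
    rcases h m₂ h1 with rfl | h4
    · exact Or.inr h3
    · exact Or.inr (h4.trans h3)
  · push Not at hprop
    exact h m₀ (by rw [next_of_no_proposal hprop, hm₀])

/-- A woman's new partner was single, or he was her partner already. -/
theorem next_eq_some_cases {w : X} {m : Y} (h : P.next k θ p r w = some m) :
    P.proposal k θ p (r m) m = some w ∨ p w = some m := by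
  rcases next_eq_some_iff.1 h with ⟨h1, -⟩ | ⟨-, h1⟩
  · exact Or.inl h1
  · exact Or.inr h1

theorem Valid.next (hp : P.Valid k p) : P.Valid k (P.next k θ p r) where
  mem w m h := by
    rcases next_eq_some_cases h with h | h
    · exact (P.symm w m).2 (mem_candidates.1 (proposal_eq_some h).2.2).1
    · exact hp.mem w m h
  inj w w' m h h' := by
    rcases next_eq_some_cases h with h | h <;> rcases next_eq_some_cases h' with h' | h'
    · exact Option.some.inj (h.symm.trans h')
    · exact absurd h' ((proposal_eq_some h).1 w')
    · exact absurd h ((proposal_eq_some h').1 w)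
    · exact hp.inj w w' m h h'
  cleared w m h w' hw' hlt hlive := by
    have hlive := live_of_live_next hlive
    rcases next_eq_some_cases h with h | h
    · have := (mem_candidates.1 (proposal_eq_some h).2.2).2.2 w' hw' hlive
      omega
    · exact hp.cleared w m h w' hw' hlt hlive

theorem valid_none : P.Valid k fun _ => none where
  mem := by simp
  inj := by simp
  cleared := by simp

/-! ### Unsettled men -/

/-- The men with at least `θ` acceptable partners. -/
def busy [Fintype Y] (P : Preferences X Y) (θ : ℕ) : Finset Y :=
  Finset.univ.filter fun m => θ ≤ (P.man m).length

open Classical in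
/-- The single men with at least `θ` acceptable partners, one of whom has not rejected them. -/
noncomputable def unsettled [Fintype Y] (P : Preferences X Y) (k θ : ℕ) (p : X → Option Y) :
    Finset Y :=
  (P.busy θ).filter fun m => (∀ w, p w ≠ some m) ∧ ∃ w ∈ P.man m, P.Live k p m w

section Unsettled

variable [Fintype Y]

omit [DecidableEq X] [DecidableEq Y] in
theorem mem_busy {m : Y} : m ∈ P.busy θ ↔ θ ≤ (P.man m).length := by simp [busy]

omit [DecidableEq X] in
theorem mem_unsettled {m : Y} : m ∈ P.unsettled k θ p ↔
    θ ≤ (P.man m).length ∧ (∀ w, p w ≠ some m) ∧ ∃ w ∈ P.man m, P.Live k p m w := by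
  simp [unsettled, mem_busy]

omit [DecidableEq X] in
theorem unsettled_subset : P.unsettled k θ p ⊆ P.busy θ := by
  classical
  exact Finset.filter_subset _ _

theorem mem_unsettled_of_proposal {m : Y} {w : X} {c : ℕ}
    (h : P.proposal k θ p c m = some w) : m ∈ P.unsettled k θ p := by
  obtain ⟨h1, h2, h3⟩ := proposal_eq_some h
  obtain ⟨h4, h5, -⟩ := mem_candidates.1 h3
  exact mem_unsettled.2 ⟨h2, h1, w, h4, h5⟩

variable [Fintype X]

open Classical in
/-- The women whose partner is a man in `S`. -/
noncomputable def matchedTo (p : X → Option Y) (S : Finset Y) : Finset X :=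
  Finset.univ.filter fun w => ∃ m ∈ S, p w = some m

omit [DecidableEq X] [Fintype Y] in
theorem mem_matchedTo {S : Finset Y} {w : X} : w ∈ matchedTo p S ↔ ∃ m ∈ S, p w = some m := by
  simp [matchedTo]

open Classical in
omit [Fintype Y] in
theorem Valid.card_matchedTo (hp : P.Valid k p) (S : Finset Y) :
    (matchedTo p S).card = (S.filter fun m => ∃ w, p w = some m).card := by
  refine Finset.card_bij (fun w hw => (mem_matchedTo.1 hw).choose) ?_ ?_ ?_
  · intro w hw
    have := (mem_matchedTo.1 hw).choose_spec
    exact Finset.mem_filter.2 ⟨this.1, w, this.2⟩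
  · intro w hw w' hw' h
    have h1 := (mem_matchedTo.1 hw).choose_spec.2
    have h2 := (mem_matchedTo.1 hw').choose_spec.2
    rw [← h] at h2
    exact hp.inj _ _ _ h1 h2
  · intro m hm
    obtain ⟨hm, w, hw⟩ := Finset.mem_filter.1 hm
    refine ⟨w, mem_matchedTo.2 ⟨m, hm, hw⟩, ?_⟩
    have := (mem_matchedTo.1 (mem_matchedTo.2 ⟨m, hm, hw⟩ : w ∈ matchedTo p S)).choose_spec.2
    exact Option.some.inj (this.symm.trans hw)

omit [Fintype Y] in
theorem Valid.card_matchedTo_le (hp : P.Valid k p) (S : Finset Y) :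
    (matchedTo p S).card ≤ S.card := by
  classical
  rw [hp.card_matchedTo]
  exact Finset.card_le_card (Finset.filter_subset _ _)

/-- A step among men of high degree does not increase the number of unsettled men of lower
degree: a displaced man is replaced by a man who proposed, and both are counted. -/
theorem Valid.card_unsettled_next_le (hp : P.Valid k p) {θ' : ℕ} (hθ : θ' ≤ θ) :
    (P.unsettled k θ' (P.next k θ p r)).card ≤ (P.unsettled k θ' p).card := by
  classical
  -- A man of the class is unsettled, matched, or rejected by everybody; the matched men are
  -- counted through their partners.
  have split : ∀ q : X → Option Y, P.Valid k q → (P.unsettled k θ' q).card +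
      (matchedTo q (P.busy θ')).card + ((P.busy θ').filter fun m => (∀ w, q w ≠ some m) ∧
        ¬ ∃ w ∈ P.man m, P.Live k q m w).card = (P.busy θ').card := by
    intro q hq
    rw [hq.card_matchedTo, unsettled,
      ← Finset.card_filter_add_card_filter_not (s := P.busy θ') (fun m => ∃ w, q w = some m),
      ← Finset.card_filter_add_card_filter_not
        (s := (P.busy θ').filter fun m => ¬ ∃ w, q w = some m)
        (fun m => ∃ w ∈ P.man m, P.Live k q m w), Finset.filter_filter, Finset.filter_filter]
    simp only [not_exists, ne_eq]
    omega
  have h1 := split p hp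
  have h2 := split _ (hp.next (θ := θ) (r := r))
  have h3 : (matchedTo p (P.busy θ')).card ≤
      (matchedTo (P.next k θ p r) (P.busy θ')).card := by
    apply Finset.card_le_card
    intro w hw
    obtain ⟨m, hm, hpw⟩ := mem_matchedTo.1 hw
    rw [mem_matchedTo]
    by_cases hprop : ∃ m₁, P.proposal k θ p (r m₁) m₁ = some w
    · obtain ⟨m₁, hm₁⟩ := hprop
      obtain ⟨m₂, h1, h2, -⟩ := next_of_proposal hm₁
      exact ⟨m₂, mem_busy.2 (hθ.trans (proposal_eq_some h2).2.1), h1⟩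
    · push Not at hprop
      exact ⟨m, hm, by rw [next_of_no_proposal hprop, hpw]⟩
  have h4 : ((P.busy θ').filter fun m => (∀ w, p w ≠ some m) ∧
      ¬ ∃ w ∈ P.man m, P.Live k p m w).card ≤
      ((P.busy θ').filter fun m => (∀ w, P.next k θ p r w ≠ some m) ∧
        ¬ ∃ w ∈ P.man m, P.Live k (P.next k θ p r) m w).card := by
    apply Finset.card_le_card
    intro m hm
    rw [Finset.mem_filter] at hm ⊢
    refine ⟨hm.1, fun w hw => ?_, ?_⟩
    · rcases next_eq_some_cases hw with h | h
      · exact hm.2.2 (mem_unsettled.1 (mem_unsettled_of_proposal h)).2.2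
      · exact hm.2.1 w h
    · rintro ⟨w, hw, hl⟩
      exact hm.2.2 ⟨w, hw, live_of_live_next hl⟩
  omega

end Unsettled

end Preferences

/-! ### Expected progress of one step -/

/-- Drawing one coordinate afresh does not change the average. -/
theorem sum_sum_update {V C : Type} [Fintype V] [DecidableEq V] [Fintype C] (v : V)
    (f : (V → C) → ℕ) :
    ∑ ω, ∑ c, f (Function.update ω v c) = Fintype.card C * ∑ ω, f ω := by
  let e : (V → C) × C → (V → C) × C := fun x => (Function.update x.1 v x.2, x.1 v)
  have he : Function.Involutive e := by
    rintro ⟨ω, c⟩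
    simp [e]
  rw [← Fintype.sum_prod_type' (f := fun ω c => f (Function.update ω v c))]
  have := Equiv.sum_comp he.toPerm fun x : (V → C) × C => f x.1
  simp only [Function.Involutive.coe_toPerm, e] at this
  rw [this, Fintype.sum_prod_type]
  simp [Finset.mul_sum]

/-- If the length of `A` divides `N`, then a uniform number below `N`, reduced modulo this length,
is the index of a uniform entry of `A`. -/
theorem card_getElem?_mod_eq {α : Type} {A : List α} (hA : A.Nodup) {a : α} (ha : a ∈ A) {N : ℕ}
    (hN : A.length ∣ N) [DecidablePred fun c : Fin N => A[c.val % A.length]? = some a] :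
    (Finset.univ.filter fun c : Fin N => A[c.val % A.length]? = some a).card * A.length = N := by
  classical
  obtain ⟨i, hi, rfl⟩ := List.mem_iff_getElem.1 ha
  have hpos : 0 < A.length := by omega
  have key : ∀ c : ℕ, A[c % A.length]? = some A[i] ↔ c ≡ i [MOD A.length] := by
    intro c
    have hc := Nat.mod_lt c hpos
    rw [List.getElem?_eq_getElem hc, Option.some.injEq, hA.getElem_inj_iff, Nat.ModEq,
      Nat.mod_eq_of_lt hi]
  have h1 : (Finset.univ.filter fun c : Fin N => A[c.val % A.length]? = some A[i]).card =
      N.count (· ≡ i [MOD A.length]) := by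
    rw [Nat.count_eq_card_filter_range]
    refine Finset.card_bij (fun c _ => c.val) ?_ ?_ ?_
    · intro c hc
      simp only [Finset.mem_filter, Finset.mem_univ, true_and] at hc
      simp [(key c.val).1 hc]
    · intro c _ c' _ h
      exact Fin.ext h
    · intro c hc
      simp only [Finset.mem_filter, Finset.mem_range] at hc
      exact ⟨⟨c, hc.1⟩, by simp [(key c).2 hc.2], rfl⟩
  rw [h1, Nat.count_modEq_card _ hpos, Nat.mod_eq_zero_of_dvd hN]
  simp [Nat.div_mul_cancel hN]

namespace Preferences

variable {X Y : Type} [DecidableEq X] [DecidableEq Y] {P : Preferences X Y} {k : ℕ}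
  {θ : ℕ} {p : X → Option Y} [Fintype X] [Fintype Y] {N : ℕ}

/-- The random numbers of the men, when all players draw numbers below `N`. -/
def coins (ω : X ⊕ Y → Fin N) (m : Y) : ℕ := (ω (Sum.inr m)).val

open Classical in
/-- The chance that an unsettled man `m` stays acceptable to a woman `w` whom he may approach is
at most twice his number of choices times the chance that she takes him. Indeed, if nobody whom
she likes better proposes to her, then redrawing the number of `m` alone makes her take him with
probability one over his number of choices. -/
theorem card_live_next_le (hN : 0 < N) {m : Y} (hm : m ∈ P.unsettled k θ p) {w : X}
    (hw : w ∈ candidates k (P.man m) (P.Live k p m))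
    (hdvd : (candidates k (P.man m) (P.Live k p m)).length ∣ N) :
    (univ.filter fun ω : X ⊕ Y → Fin N => P.Live k (P.next k θ p (coins ω)) m w).card ≤
      2 * (candidates k (P.man m) (P.Live k p m)).length *
        (univ.filter fun ω : X ⊕ Y → Fin N => P.next k θ p (coins ω) w = some m).card := by
  set A := candidates k (P.man m) (P.Live k p m) with hA
  have hmu := mem_unsettled.1 hm
  have hd : 0 < A.length := List.length_pos_of_mem hw
  -- No other man whom `w` likes better than `m` proposes to her. This does not depend on the
  -- number drawn by `m`.
  let quiet : (X ⊕ Y → Fin N) → Prop := fun ω => ∀ m', m' ≠ m →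
    P.proposal k θ p (coins ω m') m' = some w →
      (P.woman w).idxOf m ≤ (P.woman w).idxOf m'
  have ha : ∀ ω : X ⊕ Y → Fin N, P.Live k (P.next k θ p (coins ω)) m w →
      quiet ω ∨ P.next k θ p (coins ω) w = some m := by
    intro ω hl
    by_contra! hcon
    obtain ⟨hq, hne⟩ := hcon
    simp only [quiet, not_forall, not_le] at hq
    obtain ⟨m', hm', hprop, hlt⟩ := hq
    obtain ⟨m₂, h1, -, h3⟩ := next_of_proposal (r := coins ω) hprop
    rcases hl m₂ h1 with rfl | h4
    · exact hne h1
    · have := quantile_le_of_idxOf_le (k := k) (h3.trans hlt.le)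
      omega
  have hb : ∀ ω : X ⊕ Y → Fin N, quiet ω → ∀ c : Fin N, A[c.val % A.length]? = some w →
      P.next k θ p (coins (Function.update ω (Sum.inr m) c)) w = some m := by
    intro ω hq c hc
    rw [next_eq_some_iff]
    left
    constructor
    · simp only [proposal, coins, Function.update_self]
      rw [if_pos ⟨hmu.2.1, hmu.1⟩]
      exact hc
    · intro m' hm'
      by_cases h : m' = m
      · rw [h]
      · apply hq m' h
        simpa [coins, Function.update_of_ne, h] using hm'
  have hgood := card_getElem?_mod_eq (candidates_nodup (P.man_nodup m)) hw hdvd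
  rw [← hA] at hgood
  set g := (univ.filter fun c : Fin N => A[c.val % A.length]? = some w).card with hg
  have hres := sum_sum_update (C := Fin N) (Sum.inr m : X ⊕ Y) fun ω =>
    if P.next k θ p (coins ω) w = some m then 1 else 0
  -- `hres` averages over the number of `m` first.
  rw [Finset.sum_boole, Fintype.card_fin] at hres
  have hle : (univ.filter quiet).card * g ≤ ∑ ω : X ⊕ Y → Fin N, ∑ c : Fin N,
      (if P.next k θ p (coins (Function.update ω (Sum.inr m) c)) w = some m then 1 else 0) := by
    rw [Finset.card_eq_sum_ones, Finset.sum_filter, Finset.sum_mul]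
    refine Finset.sum_le_sum fun ω _ => ?_
    split_ifs with hq
    · rw [one_mul, hg, Finset.card_eq_sum_ones, Finset.sum_filter]
      refine Finset.sum_le_sum fun c _ => ?_
      by_cases hc : A[c.val % A.length]? = some w
      · rw [if_pos hc, if_pos (hb ω hq c hc)]
      · simp [hc]
    · simp
  rw [hres] at hle
  simp only [Nat.cast_id] at hle
  set a := (univ.filter fun ω : X ⊕ Y → Fin N => P.next k θ p (coins ω) w = some m).card
  have hquiet : (univ.filter quiet).card ≤ A.length * a := by
    refine Nat.le_of_mul_le_mul_left ?_ hN
    calc N * (univ.filter quiet).card = ((univ.filter quiet).card * g) * A.length := by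
          rw [mul_assoc, hgood, mul_comm]
      _ ≤ (N * a) * A.length := Nat.mul_le_mul_right _ hle
      _ = N * (A.length * a) := by ring
  calc (univ.filter fun ω : X ⊕ Y → Fin N => P.Live k (P.next k θ p (coins ω)) m w).card
      ≤ (univ.filter fun ω : X ⊕ Y → Fin N => quiet ω ∨
          P.next k θ p (coins ω) w = some m).card :=
        Finset.card_le_card fun ω hω => by
          rw [Finset.mem_filter] at hω ⊢
          exact ⟨hω.1, ha ω hω.2⟩
    _ ≤ (univ.filter quiet).card + a := by
        rw [Finset.filter_or]
        exact Finset.card_union_le _ _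
    _ ≤ A.length * a + A.length * a :=
        Nat.add_le_add hquiet (Nat.le_mul_of_pos_left _ hd)
    _ = 2 * A.length * a := by ring

variable (P k) in
/-- The women whom an unsettled man may approach. -/
noncomputable def choices (p : X → Option Y) (m : Y) : Finset X :=
  (candidates k (P.man m) (P.Live k p m)).toFinset

open Classical in
variable (P k θ) in
/-- A lower bound on the progress made by a step from `p` to `q`: the newly matched women, and
half the sum over the unsettled men of the fraction of their choices that is lost. -/
noncomputable def progress (p q : X → Option Y) : ℝ :=
  (matchedTo q (P.unsettled k θ p)).card + ∑ m ∈ P.unsettled k θ p,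
    (1 - ((P.choices k p m).filter (P.Live k q m)).card / ((P.choices k p m).card : ℝ)) / 2

omit [Fintype X] [Fintype Y] in
theorem card_choices (m : Y) :
    (P.choices k p m).card = (candidates k (P.man m) (P.Live k p m)).length :=
  List.toFinset_card_of_nodup (candidates_nodup (P.man_nodup m))

omit [Fintype X] in
theorem card_choices_pos {m : Y} (hm : m ∈ P.unsettled k θ p) : 0 < (P.choices k p m).card := by
  obtain ⟨-, -, w, hw, hl⟩ := mem_unsettled.1 hm
  rw [card_choices]
  exact List.length_pos_iff.2 (candidates_ne_nil hw hl)

theorem progress_nonneg (q : X → Option Y) : 0 ≤ P.progress k θ p q := by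
  classical
  unfold progress
  refine add_nonneg (Nat.cast_nonneg _) (Finset.sum_nonneg fun m hm => ?_)
  have : (((P.choices k p m).filter (P.Live k q m)).card : ℝ) / ((P.choices k p m).card : ℝ) ≤ 1 :=
    div_le_one_of_le₀ (Nat.cast_le.2 (Finset.card_filter_le _ _)) (Nat.cast_nonneg _)
  linarith

theorem progress_le {q : X → Option Y} (hq : P.Valid k q) :
    P.progress k θ p q ≤ 2 * (P.busy θ).card := by
  classical
  have h1 : ((matchedTo q (P.unsettled k θ p)).card : ℝ) ≤ (P.unsettled k θ p).card :=
    Nat.cast_le.2 (hq.card_matchedTo_le _)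
  have h2 : ((P.unsettled k θ p).card : ℝ) ≤ (P.busy θ).card :=
    Nat.cast_le.2 (Finset.card_le_card unsettled_subset)
  have h3 : ∑ m ∈ P.unsettled k θ p,
      (1 - ((P.choices k p m).filter (P.Live k q m)).card / ((P.choices k p m).card : ℝ)) / 2
      ≤ ∑ m ∈ P.unsettled k θ p, (1 : ℝ) := by
    refine Finset.sum_le_sum fun m hm => ?_
    have : (0 : ℝ) ≤
      (((P.choices k p m).filter (P.Live k q m)).card : ℝ) / ((P.choices k p m).card : ℝ) := by
      positivity
    linarith
  rw [Finset.sum_const, nsmul_eq_mul, mul_one] at h3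
  unfold progress
  linarith

open Classical in
/-- The expected progress is at least half the number of unsettled men. -/
theorem le_sum_progress (hN : 0 < N)
    (hdvd : ∀ m d, 0 < d → d ≤ (P.man m).length → d ∣ N) :
    (Fintype.card (X ⊕ Y → Fin N) : ℝ) * ((P.unsettled k θ p).card / 2) ≤
      ∑ ω : X ⊕ Y → Fin N, P.progress k θ p (P.next k θ p (coins ω)) := by
  set U := P.unsettled k θ p with hU
  have hpair : ∀ m ∈ U, ∀ w ∈ P.choices k p m,
      (∑ ω : X ⊕ Y → Fin N, if P.Live k (P.next k θ p (coins ω)) m w then (1 : ℝ) else 0) /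
        (P.choices k p m).card ≤
      2 * ∑ ω : X ⊕ Y → Fin N, if P.next k θ p (coins ω) w = some m then (1 : ℝ) else 0 := by
    intro m hm w hw
    have hpos := card_choices_pos hm
    rw [div_le_iff₀ (Nat.cast_pos.2 hpos), Finset.sum_boole, Finset.sum_boole]
    have hlen : (candidates k (P.man m) (P.Live k p m)).length ≤ (P.man m).length :=
      List.length_filter_le _ _
    have := card_live_next_le hN hm (List.mem_toFinset.1 hw)
      (hdvd m _ (by rwa [← card_choices]) hlen)
    rw [← card_choices] at this
    have h2 : ((univ.filter fun ω : X ⊕ Y → Fin N =>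
      P.Live k (P.next k θ p (coins ω)) m w).card : ℝ) ≤ ((2 * (P.choices k p m).card *
        (univ.filter fun ω : X ⊕ Y → Fin N => P.next k θ p (coins ω) w = some m).card : ℕ) : ℝ) :=
      Nat.cast_le.2 this
    push_cast at h2
    linarith
  -- Every man is the partner of at most one woman, and conversely.
  have hmatch : ∀ q : X → Option Y, ∑ m ∈ U, ∑ w ∈ P.choices k p m,
      (if q w = some m then (1 : ℝ) else 0) ≤ (matchedTo q U).card := by
    intro q
    calc ∑ m ∈ U, ∑ w ∈ P.choices k p m, (if q w = some m then (1 : ℝ) else 0)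
        ≤ ∑ m ∈ U, ∑ w : X, (if q w = some m then (1 : ℝ) else 0) :=
          Finset.sum_le_sum fun m _ => Finset.sum_le_sum_of_subset_of_nonneg
            (Finset.subset_univ _) fun _ _ _ => by positivity
      _ = ∑ w : X, ∑ m ∈ U, (if q w = some m then (1 : ℝ) else 0) := Finset.sum_comm
      _ ≤ ∑ w : X, (if w ∈ matchedTo q U then (1 : ℝ) else 0) := by
          refine Finset.sum_le_sum fun w _ => ?_
          cases hq : q w with
          | none => simp [mem_matchedTo, hq]
          | some m₀ =>
            simp only [Option.some.injEq, Finset.sum_ite_eq, mem_matchedTo, hq]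
            simp
      _ = (matchedTo q U).card := by simp
  have hlost : ∑ ω : X ⊕ Y → Fin N, ∑ m ∈ U,
      (((P.choices k p m).filter (P.Live k (P.next k θ p (coins ω)) m)).card : ℝ) /
        ((P.choices k p m).card : ℝ) ≤
      2 * ∑ ω : X ⊕ Y → Fin N, ((matchedTo (P.next k θ p (coins ω)) U).card : ℝ) := by
    calc _ = ∑ m ∈ U, ∑ w ∈ P.choices k p m, (∑ ω : X ⊕ Y → Fin N,
          if P.Live k (P.next k θ p (coins ω)) m w then (1 : ℝ) else 0) /
            (P.choices k p m).card := by
          rw [Finset.sum_comm]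
          refine Finset.sum_congr rfl fun m _ => ?_
          rw [← Finset.sum_div, ← Finset.sum_div, Finset.sum_comm]
          congr 1
          refine Finset.sum_congr rfl fun ω _ => ?_
          rw [Finset.sum_boole]
      _ ≤ ∑ m ∈ U, ∑ w ∈ P.choices k p m, 2 * ∑ ω : X ⊕ Y → Fin N,
            if P.next k θ p (coins ω) w = some m then (1 : ℝ) else 0 :=
          Finset.sum_le_sum fun m hm => Finset.sum_le_sum fun w hw => hpair m hm w hw
      _ = 2 * ∑ ω : X ⊕ Y → Fin N, ∑ m ∈ U, ∑ w ∈ P.choices k p m,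
            if P.next k θ p (coins ω) w = some m then (1 : ℝ) else 0 := by
          simp only [← Finset.mul_sum]
          congr 1
          rw [Finset.sum_comm]
          refine Finset.sum_congr rfl fun m _ => ?_
          rw [Finset.sum_comm]
      _ ≤ _ := by
          gcongr with ω _
          exact hmatch _
  have hexp : ∑ ω : X ⊕ Y → Fin N, P.progress k θ p (P.next k θ p (coins ω)) =
      (∑ ω : X ⊕ Y → Fin N, ((matchedTo (P.next k θ p (coins ω)) U).card : ℝ)) +
      ((Fintype.card (X ⊕ Y → Fin N) : ℝ) * U.card - ∑ ω : X ⊕ Y → Fin N, ∑ m ∈ U,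
      (((P.choices k p m).filter (P.Live k (P.next k θ p (coins ω)) m)).card : ℝ) /
        ((P.choices k p m).card : ℝ)) / 2 := by
    simp only [progress, ← hU, Finset.sum_add_distrib, ← Finset.sum_div,
      Finset.sum_sub_distrib, Finset.sum_const, nsmul_eq_mul, mul_one, Finset.card_univ]
  rw [hexp]
  linarith

/-! ### The potential -/

open Classical in
variable (P k) in
/-- The women in the `j`-th quantile of man `m` who have not rejected him. -/
noncomputable def liveIn (p : X → Option Y) (m : Y) (j : ℕ) : Finset X :=
  (P.man m).toFinset.filter fun w => P.Live k p m w ∧ quantile k (P.man m) w = j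

variable (P k θ) in
/-- What the men with at least `θ` acceptable partners can still lose, on a logarithmic scale in
each quantile. -/
noncomputable def openness (p : X → Option Y) : ℝ :=
  ∑ m ∈ P.busy θ, ∑ j ∈ Finset.range k, Real.log (1 + (P.liveIn k p m j).card)

open Classical in
variable (P k θ) in
/-- How well off woman `w` is, if her partner has at least `θ` acceptable partners. -/
noncomputable def welfareOf (p : X → Option Y) (w : X) : ℕ :=
  match p w with
  | some m => if m ∈ P.busy θ then k - quantile k (P.woman w) m else 0
  | none => 0

variable (P k θ) in
/-- The welfare of the women whose partner has at least `θ` acceptable partners: the total number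
of quantiles by which they can get worse. -/
noncomputable def welfare (p : X → Option Y) : ℕ := ∑ w : X, P.welfareOf k θ p w

theorem Valid.welfare_le (hp : P.Valid k p) : P.welfare k θ p ≤ k * (P.busy θ).card := by
  have h1 : P.welfare k θ p ≤ ∑ w ∈ matchedTo p (P.busy θ), k := by
    rw [welfare, ← Finset.sum_subset (Finset.subset_univ (matchedTo p (P.busy θ)))]
    · refine Finset.sum_le_sum fun w _ => ?_
      unfold welfareOf
      split
      · split_ifs <;> omega
      · omega
    · intro w _ hw
      rw [mem_matchedTo] at hw
      unfold welfareOf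
      split
      · next m hm => exact if_neg fun h => hw ⟨m, h, hm⟩
      · rfl
  rw [Finset.sum_const, smul_eq_mul, mul_comm] at h1
  exact h1.trans (Nat.mul_le_mul_left _ (hp.card_matchedTo_le _))

/-- Every woman who receives a proposal moves to a strictly better quantile. -/
theorem welfare_next (hk : 0 < k) {r : Y → ℕ} :
    P.welfare k θ p + (matchedTo (P.next k θ p r) (P.unsettled k θ p)).card ≤
      P.welfare k θ (P.next k θ p r) := by
  classical
  have : (matchedTo (P.next k θ p r) (P.unsettled k θ p)).card =
      ∑ w : X, if w ∈ matchedTo (P.next k θ p r) (P.unsettled k θ p) then 1 else 0 := by simp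
  rw [this, welfare, welfare, ← Finset.sum_add_distrib]
  refine Finset.sum_le_sum fun w _ => ?_
  by_cases hprop : ∃ m, P.proposal k θ p (r m) m = some w
  · obtain ⟨m, hm⟩ := hprop
    obtain ⟨m₂, h1, h2, -⟩ := next_of_proposal hm
    have hmem : m₂ ∈ P.woman w :=
      (P.symm w m₂).2 (mem_candidates.1 (proposal_eq_some h2).2.2).1
    have hq := quantile_lt hk hmem
    have hnew : P.welfareOf k θ (P.next k θ p r) w = k - quantile k (P.woman w) m₂ := by
      unfold welfareOf
      rw [h1]
      exact if_pos (mem_busy.2 (proposal_eq_some h2).2.1)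
    have hold : P.welfareOf k θ p w + 1 ≤ k - quantile k (P.woman w) m₂ := by
      unfold welfareOf
      split
      · next m₀ hm₀ =>
        have := quantile_lt_of_proposal h2 hm₀
        split_ifs <;> omega
      · omega
    rw [hnew]
    split_ifs <;> omega
  · push Not at hprop
    have h := next_of_no_proposal hprop
    have hw : w ∉ matchedTo (P.next k θ p r) (P.unsettled k θ p) := by
      rw [mem_matchedTo, h]
      rintro ⟨m, hm, hpw⟩
      exact (mem_unsettled.1 hm).2.1 w hpw
    rw [if_neg hw]
    unfold welfareOf
    rw [h]
    omega

omit [Fintype X] [Fintype Y] in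
theorem liveIn_next_subset {r : Y → ℕ} (m : Y) (j : ℕ) :
    P.liveIn k (P.next k θ p r) m j ⊆ P.liveIn k p m j := by
  classical
  intro w hw
  simp only [liveIn, Finset.mem_filter] at hw ⊢
  exact ⟨hw.1, live_of_live_next hw.2.1, hw.2.2⟩

omit [Fintype X] in
open Classical in
/-- The choices of an unsettled man are what is left of one of his quantiles. -/
theorem exists_choices_eq (hk : 0 < k) {m : Y} (hm : m ∈ P.unsettled k θ p) :
    ∃ j ∈ Finset.range k, P.choices k p m = P.liveIn k p m j ∧ ∀ r : Y → ℕ,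
      (P.choices k p m).filter (P.Live k (P.next k θ p r) m) =
        P.liveIn k (P.next k θ p r) m j := by
  obtain ⟨a, ha⟩ := Finset.card_pos.1 (card_choices_pos hm)
  have ha' := mem_candidates.1 (List.mem_toFinset.1 ha)
  have heq : P.choices k p m = P.liveIn k p m (quantile k (P.man m) a) := by
    ext w
    rw [choices, List.mem_toFinset, mem_candidates, liveIn, Finset.mem_filter, List.mem_toFinset]
    refine and_congr_right fun hw => and_congr_right fun hl => ⟨fun h => ?_, fun h b hb hlb => ?_⟩
    · exact le_antisymm (h a ha'.1 ha'.2.1) (ha'.2.2 w hw hl)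
    · rw [h]
      exact ha'.2.2 b hb hlb
  refine ⟨_, Finset.mem_range.2 (quantile_lt hk ha'.1), heq, fun r => ?_⟩
  rw [heq]
  ext w
  simp only [liveIn, Finset.mem_filter]
  constructor
  · rintro ⟨⟨h1, -, h3⟩, h4⟩
    exact ⟨h1, h4, h3⟩
  · rintro ⟨h1, h2, h3⟩
    exact ⟨⟨h1, live_of_live_next h2, h3⟩, h2⟩

theorem log_one_add_le {a d : ℝ} (ha : 0 ≤ a) (had : a ≤ d) (hd : 1 ≤ d) :
    Real.log (1 + a) + (1 - a / d) / 2 ≤ Real.log (1 + d) := by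
  have h := Real.log_le_sub_one_of_pos (show 0 < (1 + a) / (1 + d) by positivity)
  rw [Real.log_div (by positivity) (by positivity)] at h
  have h2 : (1 - a / d) / 2 ≤ 1 - (1 + a) / (1 + d) := by
    have e1 : (1 - a / d) / 2 = (d - a) / (2 * d) := by field_simp
    have e2 : 1 - (1 + a) / (1 + d) = (d - a) / (1 + d) := by
      field_simp
      ring
    rw [e1, e2]
    exact div_le_div_of_nonneg_left (by linarith) (by linarith) (by linarith)
  linarith

theorem openness_next (hk : 0 < k) {r : Y → ℕ} :
    P.openness k θ (P.next k θ p r) + P.progress k θ p (P.next k θ p r) ≤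
      P.openness k θ p + (matchedTo (P.next k θ p r) (P.unsettled k θ p)).card := by
  classical
  set q := P.next k θ p r with hq
  have hmono : ∀ m j, Real.log (1 + (P.liveIn k q m j).card) ≤
      Real.log (1 + (P.liveIn k p m j).card) := by
    intro m j
    refine Real.log_le_log (by positivity) ?_
    have : ((P.liveIn k q m j).card : ℝ) ≤ (P.liveIn k p m j).card :=
      Nat.cast_le.2 (Finset.card_le_card (liveIn_next_subset m j))
    linarith
  have hU : ∀ m ∈ P.unsettled k θ p,
      (∑ j ∈ Finset.range k, Real.log (1 + (P.liveIn k q m j).card)) +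
        (1 - ((P.choices k p m).filter (P.Live k q m)).card / ((P.choices k p m).card : ℝ)) / 2
      ≤ ∑ j ∈ Finset.range k, Real.log (1 + (P.liveIn k p m j).card) := by
    intro m hm
    obtain ⟨j, hj, h1, h2⟩ := exists_choices_eq hk hm
    have hpos := card_choices_pos hm
    rw [hq, h2 r, ← hq, h1, ← Finset.add_sum_erase _ _ hj, ← Finset.add_sum_erase _ _ hj]
    rw [h1] at hpos
    have h3 := log_one_add_le (a := (P.liveIn k q m j).card) (d := (P.liveIn k p m j).card)
      (by positivity) (Nat.cast_le.2 (Finset.card_le_card (liveIn_next_subset m j)))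
      (by exact_mod_cast hpos)
    have h4 := Finset.sum_le_sum fun i (_ : i ∈ (Finset.range k).erase j) => hmono m i
    linarith
  have hsum : P.openness k θ q + ∑ m ∈ P.unsettled k θ p,
      (1 - ((P.choices k p m).filter (P.Live k q m)).card / ((P.choices k p m).card : ℝ)) / 2
      ≤ P.openness k θ p := by
    unfold openness
    rw [← Finset.sum_sdiff (unsettled_subset (P := P) (k := k) (θ := θ) (p := p)),
      ← Finset.sum_sdiff (unsettled_subset (P := P) (k := k) (θ := θ) (p := p)),
      add_assoc, ← Finset.sum_add_distrib]
    exact add_le_add (Finset.sum_le_sum fun m _ => Finset.sum_le_sum fun j _ => hmono m j)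
      (Finset.sum_le_sum hU)
  unfold progress
  linarith

variable (P k θ) in
/-- The exponential potential of a stage among the men with at least `θ` acceptable partners. -/
noncomputable def potential (p : X → Option Y) : ℝ :=
  Real.exp ((P.openness k θ p - P.welfare k θ p) / (2 * (P.busy θ).card))

theorem potential_next_le (hk : 0 < k) {r : Y → ℕ} :
    P.potential k θ (P.next k θ p r) ≤ P.potential k θ p *
      Real.exp (-(P.progress k θ p (P.next k θ p r) / (2 * (P.busy θ).card))) := by
  unfold potential
  rw [← Real.exp_add, Real.exp_le_exp, ← sub_eq_add_neg, ← sub_div]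
  refine div_le_div_of_nonneg_right ?_ (by positivity)
  have h1 := openness_next (P := P) (θ := θ) (p := p) (r := r) hk
  have h2 : (P.welfare k θ p : ℝ) + (matchedTo (P.next k θ p r) (P.unsettled k θ p)).card ≤
      P.welfare k θ (P.next k θ p r) := by exact_mod_cast welfare_next hk
  linarith

theorem exp_neg_le_one_sub_half {x : ℝ} (h0 : 0 ≤ x) (h1 : x ≤ 1) :
    Real.exp (-x) ≤ 1 - x / 2 := by
  rw [Real.exp_neg, inv_le_iff_one_le_mul₀ (Real.exp_pos x)]
  have h := Real.add_one_le_exp x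
  nlinarith [mul_nonneg h0 (sub_nonneg.2 h1)]

/-- As long as there are many unsettled men, the potential shrinks by a constant factor in
expectation. -/
theorem Valid.sum_potential_next_le (hp : P.Valid k p) (hk : 0 < k) (hN : 0 < N)
    (hdvd : ∀ m d, 0 < d → d ≤ (P.man m).length → d ∣ N) {β : ℝ}
    (hβ : β * (P.busy θ).card < (P.unsettled k θ p).card) :
    ∑ ω : X ⊕ Y → Fin N, P.potential k θ (P.next k θ p (coins ω)) ≤
      Fintype.card (X ⊕ Y → Fin N) * ((1 - β / 8) * P.potential k θ p) := by
  rcases Nat.eq_zero_or_pos (P.busy θ).card with h0 | hS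
  · have := Finset.card_le_card (unsettled_subset (P := P) (k := k) (θ := θ) (p := p))
    rw [h0] at this
    rw [h0, Nat.le_zero.1 this] at hβ
    simp at hβ
  have hS' : (0 : ℝ) < (P.busy θ).card := Nat.cast_pos.2 hS
  set S : ℝ := ((P.busy θ).card : ℝ) with hSdef
  set D : (X ⊕ Y → Fin N) → ℝ := fun ω => P.progress k θ p (P.next k θ p (coins ω)) with hD
  have hstep : ∀ ω : X ⊕ Y → Fin N, P.potential k θ (P.next k θ p (coins ω)) ≤
      P.potential k θ p * (1 - D ω / (2 * S) / 2) := by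
    intro ω
    refine (potential_next_le hk).trans (mul_le_mul_of_nonneg_left
      (exp_neg_le_one_sub_half ?_ ?_) (Real.exp_pos _).le)
    · exact div_nonneg (progress_nonneg _) (by positivity)
    · rw [div_le_one (by positivity)]
      exact progress_le hp.next
  have hpos : 0 < P.potential k θ p := Real.exp_pos _
  have hsum := le_sum_progress (P := P) (k := k) (θ := θ) (p := p) hN hdvd
  have hΩ : (0 : ℝ) ≤ Fintype.card (X ⊕ Y → Fin N) := Nat.cast_nonneg _
  calc ∑ ω : X ⊕ Y → Fin N, P.potential k θ (P.next k θ p (coins ω))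
      ≤ ∑ ω : X ⊕ Y → Fin N, P.potential k θ p * (1 - D ω / (2 * S) / 2) :=
        Finset.sum_le_sum fun ω _ => hstep ω
    _ = P.potential k θ p * (Fintype.card (X ⊕ Y → Fin N) - (∑ ω, D ω) / (4 * S)) := by
        rw [← Finset.mul_sum, Finset.sum_sub_distrib, ← Finset.sum_div, ← Finset.sum_div,
          Finset.sum_const, Finset.card_univ, nsmul_eq_mul, mul_one]
        congr 2
        rw [div_div]
        congr 1
        ring
    _ ≤ P.potential k θ p * (Fintype.card (X ⊕ Y → Fin N) -
          Fintype.card (X ⊕ Y → Fin N) * (β / 8)) := by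
        refine mul_le_mul_of_nonneg_left (sub_le_sub_left ?_ _) hpos.le
        rw [le_div_iff₀ (by positivity)]
        calc (Fintype.card (X ⊕ Y → Fin N) : ℝ) * (β / 8) * (4 * S)
            = Fintype.card (X ⊕ Y → Fin N) * (β * S / 2) := by ring
          _ ≤ Fintype.card (X ⊕ Y → Fin N) * ((P.unsettled k θ p).card / 2) :=
              mul_le_mul_of_nonneg_left (by linarith) hΩ
          _ ≤ _ := hsum
    _ = _ := by ring

theorem potential_le {n : ℕ} (hn : ∀ m, (P.man m).length ≤ n) :
    P.potential k θ p ≤ Real.exp (k * Real.log (1 + n) / 2) := by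
  classical
  unfold potential
  have hop : P.openness k θ p ≤ (P.busy θ).card * (k * Real.log (1 + n)) := by
    have : ∀ m ∈ P.busy θ, ∑ j ∈ Finset.range k, Real.log (1 + (P.liveIn k p m j).card) ≤
        k * Real.log (1 + n) := by
      intro m _
      calc _ ≤ ∑ j ∈ Finset.range k, Real.log (1 + n) := by
            refine Finset.sum_le_sum fun j _ => Real.log_le_log (by positivity) ?_
            have : (P.liveIn k p m j).card ≤ n :=
              (Finset.card_filter_le _ _).trans ((List.toFinset_card_le _).trans (hn m))
            have : ((P.liveIn k p m j).card : ℝ) ≤ n := Nat.cast_le.2 this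
            linarith
        _ = _ := by simp
    simpa [openness] using Finset.sum_le_sum this
  have hlog : 0 ≤ Real.log (1 + n) := Real.log_nonneg (by simp)
  rw [Real.exp_le_exp]
  rcases Nat.eq_zero_or_pos (P.busy θ).card with h0 | hS
  · rw [h0]
    simp only [Nat.cast_zero, mul_zero, div_zero]
    positivity
  have hS' : (0 : ℝ) < (P.busy θ).card := Nat.cast_pos.2 hS
  rw [div_le_iff₀ (by positivity)]
  have : (0 : ℝ) ≤ P.welfare k θ p := Nat.cast_nonneg _
  linarith

theorem Valid.le_potential (hp : P.Valid k p) : Real.exp (-(k / 2)) ≤ P.potential k θ p := by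
  unfold potential
  have hop : 0 ≤ P.openness k θ p := Finset.sum_nonneg fun m _ => Finset.sum_nonneg fun j _ =>
    Real.log_nonneg (by simp)
  have hw : (P.welfare k θ p : ℝ) ≤ k * (P.busy θ).card := by exact_mod_cast hp.welfare_le
  rw [Real.exp_le_exp]
  rcases Nat.eq_zero_or_pos (P.busy θ).card with h0 | hS
  · rw [h0]
    simp only [Nat.cast_zero, mul_zero, div_zero]
    have : (0 : ℝ) ≤ k := Nat.cast_nonneg _
    linarith
  have hS' : (0 : ℝ) < (P.busy θ).card := Nat.cast_pos.2 hS
  rw [le_div_iff₀ (by positivity)]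
  linarith

end Preferences

/-! ### Random iteration -/

/-- The law after `t` steps of the time-dependent random dynamics `next` started at `s₀`, where
every step uses a fresh uniform element of `Ω`. -/
noncomputable def iterationLaw {σ Ω : Type} [Fintype Ω] [Nonempty Ω] (next : ℕ → σ → Ω → σ)
    (s₀ : σ) : ℕ → PMF σ
  | 0 => PMF.pure s₀
  | t + 1 => (iterationLaw next s₀ t).bind fun s => (PMF.uniformOfFintype Ω).map (next t s)

namespace DistributedAlgorithm

variable {I O V σ : Type} [Fintype V] [DecidableEq V] (A : DistributedAlgorithm I O)
  {G : SimpleGraph V} {uid : V → ℕ} {input : V → I} {next : ℕ → σ → (V → A.Coin) → σ} {s₀ : σ}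
  {conf : ℕ → σ → A.Config V} {mid : ℕ → σ → (V → A.Coin) → A.Config V}

/-- If a step of the dynamics is simulated by two rounds of an algorithm, where the randomness of
the second one is irrelevant, then the configurations are distributed as the dynamics says. -/
theorem law_eq_map_iterationLaw
    (h0 : ∀ r, A.round G uid (A.initConfig input) r = conf 0 s₀)
    (h1 : ∀ t s r, A.round G uid (conf t s) r = mid t s r)
    (h2 : ∀ t s r r', A.round G uid (mid t s r) r' = conf (t + 1) (next t s r)) (t : ℕ) :
    A.law G uid input (2 * t + 1) = (iterationLaw next s₀ t).map (conf t) := by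
  induction t with
  | zero =>
    rw [law, law, PMF.pure_bind, iterationLaw, PMF.pure_map,
      show (fun r => A.round G uid (A.initConfig input) r) = Function.const _ (conf 0 s₀) from
        funext h0, PMF.map_const]
  | succ t ih =>
    rw [show 2 * (t + 1) + 1 = 2 * t + 1 + 1 + 1 by ring, law, law, ih, iterationLaw,
      PMF.bind_map, PMF.bind_bind, PMF.map_bind]
    congr 1
    funext s
    rw [PMF.map_comp, Function.comp_apply,
      show (fun r => A.round G uid (conf t s) r) = mid t s from funext (h1 t s), PMF.bind_map,
      ← PMF.bind_pure_comp]
    congr 1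
    funext r
    rw [Function.comp_apply, show (fun r' => A.round G uid (mid t s r) r') =
      Function.const _ (conf (t + 1) (next t s r)) from funext (h2 t s r), PMF.map_const]
    rfl

theorem outputLaw_eq_map_iterationLaw {T : ℕ} {out : σ → V → O} (hT : A.rounds = 2 * T + 2)
    (h0 : ∀ r, A.round G uid (A.initConfig input) r = conf 0 s₀)
    (h1 : ∀ t s r, A.round G uid (conf t s) r = mid t s r)
    (h2 : ∀ t s r r', A.round G uid (mid t s r) r' = conf (t + 1) (next t s r))
    (hout : ∀ s r v, A.output (mid T s r v).1 = out s v) :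
    A.outputLaw G uid input = (iterationLaw next s₀ T).map out := by
  rw [outputLaw, hT, law, law_eq_map_iterationLaw A h0 h1 h2, PMF.bind_map, PMF.map_bind,
    ← PMF.bind_pure_comp]
  congr 1
  funext s
  rw [Function.comp_apply, PMF.map_comp,
    show ((fun c v => A.output (c v).1) ∘ fun r => A.round G uid (conf T s) r) =
      Function.const _ (out s) from funext fun r => funext fun v => by
        simp only [Function.comp_apply, h1, hout, Function.const_apply], PMF.map_const]
  rfl

end DistributedAlgorithm

/-! ### The distributed algorithm -/

/-- The state of a player: its input, the number of rounds performed, and the id of its partner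
as far as it is known to the player. -/
structure PlayerState where
  input : PlayerInput
  clock : ℕ
  partner : Option ℕ

open Classical in
/-- What a woman with preference list `l` and partner `cur` tells the man with id `i`: whether he
is her partner, or is still acceptable. No message means that he is rejected. -/
noncomputable def statusMessage (k : ℕ) (l : List ℕ) (cur : Option ℕ) (i : ℕ) : Option Message :=
  if cur = some i then some [true] else if Acceptable k l cur i then some [false] else none

open Classical in
/-- A woman takes her best proposer, if any, and announces her new status. -/
noncomputable def womanStep (k : ℕ) (s : PlayerState) (inbox : Set (ℕ × Message)) :
    PlayerState × (ℕ → Option Message) :=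
  let cur := (s.input.prefs.find? fun i => ∃ b, (i, b) ∈ inbox).or s.partner
  (⟨s.input, s.clock + 1, cur⟩, statusMessage k s.input.prefs cur)

open Classical in
/-- A man reads off his partner from the announcements; if he is single and has at least `θ`
acceptable partners, he proposes to a random woman of his best quantile with a woman who has not
rejected him. -/
noncomputable def manStep (k θ : ℕ) (s : PlayerState) (inbox : Set (ℕ × Message)) (c : ℕ) :
    PlayerState × (ℕ → Option Message) :=
  let partner := s.input.prefs.find? fun i => (i, [true]) ∈ inbox
  let A := candidates k s.input.prefs fun i => ∃ b, (i, b) ∈ inbox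
  (⟨s.input, s.clock + 1, partner⟩, fun i =>
    if (partner = none ∧ θ ≤ s.input.prefs.length) ∧ A[c % A.length]? = some i
      then some [] else none)

/-- The women act in the even rounds, the men in the odd ones. Every `τ` steps the number of
acceptable partners that a man needs in order to propose is doubled. -/
noncomputable def playerStep (k τ : ℕ) (s : PlayerState) (inbox : Set (ℕ × Message)) (c : ℕ) :
    PlayerState × (ℕ → Option Message) :=
  match s.input.gender, s.clock % 2 with
  | Gender.female, 0 => womanStep k s inbox
  | Gender.female, _ + 1 => (⟨s.input, s.clock + 1, s.partner⟩, fun _ => none)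
  | Gender.male, 0 => (⟨s.input, s.clock + 1, none⟩, fun _ => none)
  | Gender.male, _ + 1 => manStep k (2 ^ (s.clock / 2 / τ)) s inbox c

/-- `T` steps of the proposal dynamics as a message-passing algorithm. -/
noncomputable def randASM (k τ T N : ℕ) [NeZero N] :
    DistributedAlgorithm PlayerInput (Option ℕ) where
  State := PlayerState
  Coin := Fin N
  rounds := 2 * T + 2
  init i := ⟨i, 0, none⟩
  step s inbox c := playerStep k τ s inbox c.val
  output s := s.partner

theorem statusMessage_length {k : ℕ} {l : List ℕ} {cur : Option ℕ} {i : ℕ} {b : Message}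
    (h : statusMessage k l cur i = some b) : b.length ≤ 1 := by
  unfold statusMessage at h
  split_ifs at h <;> simp only [Option.some.injEq] at h <;> simp [← h]

theorem playerStep_length {k τ : ℕ} {s : PlayerState} {inbox : Set (ℕ × Message)} {c i : ℕ}
    {b : Message} (h : (playerStep k τ s inbox c).2 i = some b) : b.length ≤ 1 := by
  unfold playerStep at h
  split at h
  · exact statusMessage_length h
  · simp at h
  · simp at h
  · simp only [manStep] at h
    split_ifs at h
    simp only [Option.some.injEq] at h
    simp [← h]

theorem randASM_messagesAtMost {V : Type} [Fintype V] [DecidableEq V] {G : SimpleGraph V}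
    {uid : V → ℕ} {input : V → PlayerInput} {k τ T N : ℕ} [NeZero N] {b : ℝ} (hb : 1 ≤ b) :
    (randASM k τ T N).MessagesAtMost G uid input b := by
  intro t _ c hc u v _ m hm
  cases t with
  | zero =>
    rw [DistributedAlgorithm.law, PMF.mem_support_pure_iff] at hc
    subst hc
    simp [DistributedAlgorithm.initConfig] at hm
  | succ t =>
    rw [DistributedAlgorithm.law, PMF.mem_support_bind_iff] at hc
    obtain ⟨c', -, hc⟩ := hc
    obtain ⟨r, -, rfl⟩ := (PMF.mem_support_map_iff _ _ _).1 hc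
    exact (Nat.cast_le_one.2 (playerStep_length hm)).trans hb

section Congr

variable {α : Type}

theorem find?_congr_of_mem {l : List α} {q q' : α → Bool} (h : ∀ a ∈ l, q a = q' a) :
    l.find? q = l.find? q' := by
  induction l with
  | nil => rfl
  | cons a l ih =>
    rw [List.find?_cons, List.find?_cons, h a List.mem_cons_self,
      ih fun b hb => h b (List.mem_cons_of_mem _ hb)]

theorem candidates_congr [DecidableEq α] {k : ℕ} {l : List α} {q q' : α → Prop}
    (h : ∀ a ∈ l, (q a ↔ q' a)) : candidates k l q = candidates k l q' := by
  unfold candidates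
  apply List.filter_congr
  intro a ha
  have : (∀ b ∈ l, q b → quantile k l a ≤ quantile k l b) ↔
      ∀ b ∈ l, q' b → quantile k l a ≤ quantile k l b :=
    forall₂_congr fun b hb => by rw [h b hb]
  simp [h a ha, this]

end Congr

namespace Preferences

variable {X Y : Type} [DecidableEq X] [DecidableEq Y] (P : Preferences X Y) (k τ : ℕ)
  (uid : X ⊕ Y → ℕ)

/-- The configuration after `2 * t + 1` rounds, when `p` assigns the partners of the women. -/
noncomputable def announced (t : ℕ) (p : X → Option Y) :
    X ⊕ Y → PlayerState × (ℕ → Option Message)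
  | Sum.inl x => (⟨P.playerInput uid (Sum.inl x), 2 * t + 1, (p x).map fun y => uid (Sum.inr y)⟩,
      statusMessage k ((P.woman x).map fun y => uid (Sum.inr y))
        ((p x).map fun y => uid (Sum.inr y)))
  | Sum.inr y => (⟨P.playerInput uid (Sum.inr y), 2 * t + 1, none⟩, fun _ => none)

open Classical in
/-- The outputs of the players, when `p` assigns the partners of the women. -/
noncomputable def outputs (p : X → Option Y) : X ⊕ Y → Option ℕ
  | Sum.inl x => (p x).map fun y => uid (Sum.inr y)
  | Sum.inr y => ((P.man y).find? fun x => p x = some y).map fun x => uid (Sum.inl x)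

open Classical in
/-- The configuration after `2 * t + 2` rounds, when the men have drawn `r` in the last one. -/
noncomputable def proposed (t : ℕ) (p : X → Option Y) (r : Y → ℕ) :
    X ⊕ Y → PlayerState × (ℕ → Option Message)
  | Sum.inl x => (⟨P.playerInput uid (Sum.inl x), 2 * t + 2, P.outputs uid p (Sum.inl x)⟩,
      fun _ => none)
  | Sum.inr y => (⟨P.playerInput uid (Sum.inr y), 2 * t + 2, P.outputs uid p (Sum.inr y)⟩,
      fun i => if ∃ x, P.proposal k (2 ^ (t / τ)) p (r y) y = some x ∧ uid (Sum.inl x) = i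
        then some [] else none)

variable {P k τ uid} {p : X → Option Y} {r : Y → ℕ}

omit [DecidableEq X] [DecidableEq Y] in
theorem commGraph_adj_inl_inr {x : X} {y : Y} :
    P.commGraph.Adj (Sum.inl x) (Sum.inr y) ↔ y ∈ P.woman x := by
  simp [commGraph, edges, ← P.symm]

variable (hu : Function.Injective uid)

include hu

omit [DecidableEq X] in
theorem statusMessage_eq_true {x : X} {y : Y} :
    statusMessage k ((P.woman x).map fun y => uid (Sum.inr y))
      ((p x).map fun y => uid (Sum.inr y)) (uid (Sum.inr y)) = some [true] ↔ p x = some y := by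
  have hinj : Function.Injective fun y : Y => uid (Sum.inr y) := hu.comp Sum.inr_injective
  have h : (p x).map (fun y => uid (Sum.inr y)) = some (uid (Sum.inr y)) ↔ p x = some y := by
    rw [Option.map_eq_some_iff]
    exact ⟨fun ⟨a, h1, h2⟩ => by rw [h1, hinj h2], fun h => ⟨y, h, rfl⟩⟩
  simp only [statusMessage, h]
  split_ifs <;> simp_all

omit [DecidableEq X] in
theorem exists_statusMessage_eq {x : X} {y : Y} :
    (∃ b, statusMessage k ((P.woman x).map fun y => uid (Sum.inr y))
      ((p x).map fun y => uid (Sum.inr y)) (uid (Sum.inr y)) = some b) ↔ P.Live k p y x := by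
  have hinj : Function.Injective fun y : Y => uid (Sum.inr y) := hu.comp Sum.inr_injective
  have h : (p x).map (fun y => uid (Sum.inr y)) = some (uid (Sum.inr y)) ↔ p x = some y := by
    rw [Option.map_eq_some_iff]
    exact ⟨fun ⟨a, h1, h2⟩ => by rw [h1, hinj h2], fun h => ⟨y, h, rfl⟩⟩
  have hacc := acceptable_map hinj k (P.woman x) (p x) y
  simp only [statusMessage, h, Live]
  split_ifs with h1 h2
  · simp only [Option.some.injEq, exists_eq', true_iff]
    intro b hb
    exact Or.inl (Option.some.inj (h1.symm.trans hb))
  · simpa using hacc.1 h2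
  · simpa using mt hacc.2 h2

variable {T N : ℕ} [NeZero N]

omit [DecidableEq X] [DecidableEq Y] in
theorem mem_inbox_announced {t : ℕ} {x : X} {y : Y} (hx : x ∈ P.man y) {b : Message} :
    (uid (Sum.inl x), b) ∈ (randASM k τ T N).inbox P.commGraph uid (P.announced k uid t p)
      (Sum.inr y) ↔ statusMessage k ((P.woman x).map fun y => uid (Sum.inr y))
      ((p x).map fun y => uid (Sum.inr y)) (uid (Sum.inr y)) = some b := by
  constructor
  · rintro ⟨u, -, h2, h3⟩
    rw [← hu h2] at h3
    exact h3
  · intro h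
    exact ⟨Sum.inl x, commGraph_adj_inl_inr.2 ((P.symm x y).2 hx), rfl, h⟩

/-- In an odd round the men read the announcements and propose. -/
theorem round_announced (hp : P.Valid k p) (t : ℕ) (ω : X ⊕ Y → Fin N) :
    (randASM k τ T N).round P.commGraph uid (P.announced k uid t p) ω =
      P.proposed k τ uid t p (coins ω) := by
  classical
  have hinj : Function.Injective fun x : X => uid (Sum.inl x) := hu.comp Sum.inl_injective
  funext v
  rcases v with x | y
  · simp only [DistributedAlgorithm.round, randASM, announced, playerStep, playerInput, proposed,
      outputs]
    have : (2 * t + 1) % 2 = 0 + 1 := by omega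
    rw [this]
  · have hclock : (2 * t + 1) % 2 = 0 + 1 := by omega
    have hhalf : (2 * t + 1) / 2 = t := by omega
    set I := (randASM k τ T N).inbox P.commGraph uid (P.announced k uid t p) (Sum.inr y) with hI
    have hstep : (randASM k τ T N).round P.commGraph uid (P.announced k uid t p) ω (Sum.inr y) =
        manStep k (2 ^ (t / τ)) ⟨P.playerInput uid (Sum.inr y), 2 * t + 1, none⟩ I
          (coins ω y) := by
      change playerStep k τ ⟨P.playerInput uid (Sum.inr y), 2 * t + 1, none⟩ I _ = _
      simp only [playerStep, playerInput]
      rw [hclock, hhalf]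
      rfl
    have hpartner : ((P.man y).map fun x => uid (Sum.inl x)).find?
        (fun i => decide ((i, [true]) ∈ I)) = P.outputs uid p (Sum.inr y) := by
      rw [List.find?_map, outputs]
      congr 1
      apply find?_congr_of_mem
      intro x hx
      simp only [Function.comp, decide_eq_decide]
      rw [hI, mem_inbox_announced hu hx, statusMessage_eq_true hu]
    have hcand : candidates k ((P.man y).map fun x => uid (Sum.inl x))
        (fun i => ∃ b, (i, b) ∈ I) =
        (candidates k (P.man y) (P.Live k p y)).map fun x => uid (Sum.inl x) := by
      rw [candidates_map hinj]
      congr 1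
      apply candidates_congr
      intro x hx
      rw [← exists_statusMessage_eq hu (P := P) (k := k)]
      exact exists_congr fun b => mem_inbox_announced hu hx
    have hsingle : P.outputs uid p (Sum.inr y) = none ↔ ∀ w, p w ≠ some y := by
      simp only [outputs, Option.map_eq_none_iff, List.find?_eq_none, decide_eq_true_eq]
      exact ⟨fun h w hw => h w ((P.symm w y).1 (hp.mem w y hw)) hw, fun h w _ => h w⟩
    rw [hstep]
    simp only [manStep, playerInput, proposed, hpartner, hcand, hsingle, List.length_map,
      List.getElem?_map]
    congr 1
    funext i
    apply if_congr ?_ rfl rfl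
    simp only [proposal, Option.map_eq_some_iff]
    split_ifs with h
    · simp [h]
    · simp [h]

/-- In an even round the women answer the proposals and announce the outcome. -/
theorem round_proposed (t : ℕ) (ω : X ⊕ Y → Fin N) :
    (randASM k τ T N).round P.commGraph uid (P.proposed k τ uid t p r) ω =
      P.announced k uid (t + 1) (P.next k (2 ^ (t / τ)) p r) := by
  classical
  have hinj : Function.Injective fun y : Y => uid (Sum.inr y) := hu.comp Sum.inr_injective
  funext v
  have hclock : (2 * t + 2) % 2 = 0 := by omega
  rcases v with x | y
  · set I := (randASM k τ T N).inbox P.commGraph uid (P.proposed k τ uid t p r) (Sum.inl x) with hI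
    have hstep : (randASM k τ T N).round P.commGraph uid (P.proposed k τ uid t p r) ω
        (Sum.inl x) = womanStep k ⟨P.playerInput uid (Sum.inl x), 2 * t + 2,
          P.outputs uid p (Sum.inl x)⟩ I := by
      change playerStep k τ ⟨P.playerInput uid (Sum.inl x), 2 * t + 2,
          P.outputs uid p (Sum.inl x)⟩ I _ = _
      simp only [playerStep, playerInput]
      rw [hclock]
    have hcur : (((P.woman x).map fun y => uid (Sum.inr y)).find?
        (fun i => decide (∃ b, (i, b) ∈ I))).or (P.outputs uid p (Sum.inl x)) =
        (P.next k (2 ^ (t / τ)) p r x).map fun y => uid (Sum.inr y) := by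
      rw [List.find?_map, outputs, ← Option.map_or, next]
      congr 2
      apply find?_congr_of_mem
      intro y hy
      simp only [Function.comp, decide_eq_decide]
      constructor
      · rintro ⟨b, u, -, h2, h3⟩
        rw [← hu h2] at h3
        simp only [proposed] at h3
        split_ifs at h3 with h4
        obtain ⟨x', h5, h6⟩ := h4
        rw [h5, Sum.inl_injective (hu h6)]
      · intro h
        refine ⟨[], Sum.inr y, (commGraph_adj_inl_inr.2 hy).symm, rfl, ?_⟩
        exact if_pos ⟨x, h, rfl⟩
    rw [hstep]
    simp only [womanStep, playerInput, hcur, announced]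
    rfl
  · simp only [DistributedAlgorithm.round, randASM, announced, playerStep, playerInput, proposed]
    rw [hclock]
    rfl

omit [DecidableEq X] [DecidableEq Y] hu in
theorem round_initConfig (ω : X ⊕ Y → Fin N) :
    (randASM k τ T N).round P.commGraph uid
      ((randASM k τ T N).initConfig (P.playerInput uid)) ω =
      P.announced k uid 0 fun _ => none := by
  classical
  funext v
  rcases v with x | y
  · set I := (randASM k τ T N).inbox P.commGraph uid
      ((randASM k τ T N).initConfig (P.playerInput uid)) (Sum.inl x)
    have hempty : ∀ i b, (i, b) ∉ I := by
      rintro i b ⟨u, -, -, h⟩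
      simp [DistributedAlgorithm.initConfig] at h
    change playerStep k τ ⟨P.playerInput uid (Sum.inl x), 0, none⟩ I (ω (Sum.inl x)).val = _
    have hfind : (P.woman x).find? (fun _ => false) = none := by simp
    simp [playerStep, playerInput, womanStep, hempty, announced, hfind]
  · simp [DistributedAlgorithm.round, DistributedAlgorithm.initConfig, randASM, announced,
      playerStep, playerInput]

variable [Fintype X] [Fintype Y]

variable (P k τ N) in
/-- The law of the dynamics after `t` steps, with random numbers below `N`. -/
noncomputable def chain : ℕ → PMF {p : X → Option Y // P.Valid k p} :=
  iterationLaw (fun t p (ω : X ⊕ Y → Fin N) => ⟨P.next k (2 ^ (t / τ)) p.1 (coins ω), p.2.next⟩)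
    ⟨fun _ => none, valid_none⟩

/-- The outputs of the algorithm are distributed as those of the dynamics. -/
theorem outputLaw_randASM :
    (randASM k τ T N).outputLaw P.commGraph uid (P.playerInput uid) =
      (P.chain k τ N T).map fun p => P.outputs uid p.1 :=
  DistributedAlgorithm.outputLaw_eq_map_iterationLaw (randASM k τ T N)
    (conf := fun t (p : {p : X → Option Y // P.Valid k p}) => P.announced k uid t p.1)
    (mid := fun t (p : {p : X → Option Y // P.Valid k p}) (ω : X ⊕ Y → Fin N) =>
      P.proposed k τ uid t p.1 (coins ω)) rfl
    (fun ω => round_initConfig (k := k) (τ := τ) (T := T) (N := N) ω)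
    (fun t p ω => round_announced (T := T) hu p.2 t ω)
    (fun t _ _ ω => round_proposed (T := T) hu t ω)
    (by rintro p ω (x | y) <;> rfl)

end Preferences

open scoped ENNReal

/-! ### Failure probability -/

section Iteration

variable {σ Ω : Type} [Fintype Ω] [Nonempty Ω] {next : ℕ → σ → Ω → σ} {s₀ : σ}

theorem tsum_iterationLaw_succ (t : ℕ) (F : σ → ℝ≥0∞) :
    ∑' s, iterationLaw next s₀ (t + 1) s * F s =
      ∑' s, iterationLaw next s₀ t s * ((Fintype.card Ω : ℝ≥0∞)⁻¹ * ∑ ω, F (next t s ω)) := by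
  have key : ∀ s : σ, ∑' b, ((PMF.uniformOfFintype Ω).map (next t s)) b * F b =
      (Fintype.card Ω : ℝ≥0∞)⁻¹ * ∑ ω, F (next t s ω) := by
    intro s
    calc ∑' b, ((PMF.uniformOfFintype Ω).map (next t s)) b * F b
        = ∑' b, ∑' ω, (PMF.uniformOfFintype Ω) ω * (PMF.pure (next t s ω) b * F b) := by
          refine tsum_congr fun b => ?_
          rw [← PMF.bind_pure_comp, PMF.bind_apply, ← ENNReal.tsum_mul_right]
          exact tsum_congr fun ω => mul_assoc _ _ _
      _ = ∑' ω, (PMF.uniformOfFintype Ω) ω * ∑' b, PMF.pure (next t s ω) b * F b := by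
          rw [ENNReal.tsum_comm]
          exact tsum_congr fun ω => ENNReal.tsum_mul_left
      _ = ∑' ω, (Fintype.card Ω : ℝ≥0∞)⁻¹ * F (next t s ω) := by
          refine tsum_congr fun ω => ?_
          rw [PMF.uniformOfFintype_apply, tsum_eq_single (next t s ω)]
          · simp
          · intro b hb
            simp [PMF.pure_apply, hb]
      _ = _ := by rw [tsum_fintype, Finset.mul_sum]
  calc ∑' b, iterationLaw next s₀ (t + 1) b * F b
      = ∑' b, ∑' s, iterationLaw next s₀ t s *
          (((PMF.uniformOfFintype Ω).map (next t s)) b * F b) := by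
        refine tsum_congr fun b => ?_
        rw [iterationLaw, PMF.bind_apply, ← ENNReal.tsum_mul_right]
        exact tsum_congr fun s => mul_assoc _ _ _
    _ = ∑' s, iterationLaw next s₀ t s *
          ∑' b, ((PMF.uniformOfFintype Ω).map (next t s)) b * F b := by
        rw [ENNReal.tsum_comm]
        exact tsum_congr fun s => ENNReal.tsum_mul_left
    _ = _ := tsum_congr fun s => by rw [key]

theorem tsum_iterationLaw_succ_le {t : ℕ} {F : σ → ℝ≥0∞} {c : ℝ≥0∞}
    (h : ∀ s, ∑ ω, F (next t s ω) ≤ Fintype.card Ω * (c * F s)) :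
    ∑' s, iterationLaw next s₀ (t + 1) s * F s ≤ c * ∑' s, iterationLaw next s₀ t s * F s := by
  rw [tsum_iterationLaw_succ, ← ENNReal.tsum_mul_left]
  refine ENNReal.tsum_le_tsum fun s => ?_
  have h1 : (Fintype.card Ω : ℝ≥0∞)⁻¹ * ∑ ω, F (next t s ω) ≤ c * F s := by
    rw [mul_comm, ← div_eq_mul_inv]
    exact ENNReal.div_le_of_le_mul' (h s)
  calc _ ≤ iterationLaw next s₀ t s * (c * F s) := mul_le_mul_right h1 _
    _ = _ := by ring

end Iteration

namespace Preferences

variable {X Y : Type} [DecidableEq X] [DecidableEq Y] {P : Preferences X Y} {k τ : ℕ}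
  [Fintype X] [Fintype Y] {N : ℕ} [NeZero N]

variable (P k) in
/-- The states in which more than a fraction `β` of the men with at least `θ` acceptable partners
is unsettled. -/
def crowded (θ : ℕ) (β : ℝ) : Set {p : X → Option Y // P.Valid k p} :=
  {p | β * (P.busy θ).card < (P.unsettled k θ p.1).card}

/-- The probability that too many men of degree at least `2 ^ i` are unsettled after stage `i`. -/
theorem chain_crowded_le {n : ℕ} (hn : ∀ m, (P.man m).length ≤ n)
    (hdvd : ∀ m d, 0 < d → d ≤ (P.man m).length → d ∣ N) (hk : 0 < k) (hτ : 0 < τ)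
    {β : ℝ} (hβ : β ≤ 8) {i T : ℕ} (hT : (i + 1) * τ ≤ T) :
    (P.chain k τ N T).toOuterMeasure (P.crowded k (2 ^ i) β) ≤
      ENNReal.ofReal (Real.exp (k * (1 + Real.log (1 + n)) / 2 - β / 8 * τ)) := by
  classical
  have hN : 0 < N := Nat.pos_of_ne_zero (NeZero.ne N)
  -- The potential, cut off once few men are unsettled; it controls the stage itself. The
  -- indicator `G` carries the result over to the later stages.
  let F : {p : X → Option Y // P.Valid k p} → ℝ≥0∞ := fun p =>
    if p ∈ P.crowded k (2 ^ i) β then ENNReal.ofReal (P.potential k (2 ^ i) p.1) else 0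
  let G : {p : X → Option Y // P.Valid k p} → ℝ≥0∞ := fun p =>
    if p ∈ P.crowded k (2 ^ i) β then 1 else 0
  have hmono : ∀ (p : {p : X → Option Y // P.Valid k p}) (t : ℕ) (ω : X ⊕ Y → Fin N),
      i ≤ t / τ → (⟨P.next k (2 ^ (t / τ)) p.1 (coins ω), p.2.next⟩ :
        {p : X → Option Y // P.Valid k p}) ∈ P.crowded k (2 ^ i) β →
      p ∈ P.crowded k (2 ^ i) β := by
    intro p t ω ht h
    have h1 := p.2.card_unsettled_next_le (r := coins ω) (Nat.pow_le_pow_right two_pos ht)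
    have h2 : β * (P.busy (2 ^ i)).card <
        (P.unsettled k (2 ^ i) (P.next k (2 ^ (t / τ)) p.1 (coins ω))).card := h
    exact h2.trans_le (Nat.cast_le.2 h1)
  have hc0 : 0 ≤ 1 - β / 8 := by linarith
  have hFstep : ∀ t, t / τ = i →
      ∑' p, P.chain k τ N (t + 1) p * F p ≤
        ENNReal.ofReal (1 - β / 8) * ∑' p, P.chain k τ N t p * F p := by
    intro t ht
    refine tsum_iterationLaw_succ_le fun p => ?_
    by_cases hp : p ∈ P.crowded k (2 ^ i) β
    · have h1 := p.2.sum_potential_next_le hk hN hdvd hp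
      calc ∑ ω : X ⊕ Y → Fin N, F ⟨P.next k (2 ^ (t / τ)) p.1 (coins ω), p.2.next⟩
          ≤ ∑ ω : X ⊕ Y → Fin N,
              ENNReal.ofReal (P.potential k (2 ^ i) (P.next k (2 ^ i) p.1 (coins ω))) := by
            refine Finset.sum_le_sum fun ω _ => ?_
            simp only [F, ht]
            split_ifs
            · exact le_rfl
            · exact zero_le
        _ = ENNReal.ofReal
              (∑ ω : X ⊕ Y → Fin N, P.potential k (2 ^ i) (P.next k (2 ^ i) p.1 (coins ω))) :=
            (ENNReal.ofReal_sum_of_nonneg fun ω _ => (Real.exp_pos _).le).symm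
        _ ≤ ENNReal.ofReal (Fintype.card (X ⊕ Y → Fin N) *
              ((1 - β / 8) * P.potential k (2 ^ i) p.1)) := ENNReal.ofReal_le_ofReal h1
        _ = _ := by
            rw [ENNReal.ofReal_mul (Nat.cast_nonneg _), ENNReal.ofReal_mul hc0,
              ENNReal.ofReal_natCast]
            simp only [F, if_pos hp]
    · rw [Finset.sum_eq_zero]
      · exact zero_le
      · intro ω _
        exact if_neg fun h => hp (hmono p t ω ht.ge h)
  have hF : ∀ j ≤ τ, ∑' p, P.chain k τ N (i * τ + j) p * F p ≤
      ENNReal.ofReal (1 - β / 8) ^ j *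
        ENNReal.ofReal (Real.exp (k * Real.log (1 + n) / 2)) := by
    intro j
    induction j with
    | zero =>
      intro _
      rw [pow_zero, one_mul, add_zero]
      calc ∑' p, P.chain k τ N (i * τ) p * F p
          ≤ ∑' p, P.chain k τ N (i * τ) p *
              ENNReal.ofReal (Real.exp (k * Real.log (1 + n) / 2)) := by
            refine ENNReal.tsum_le_tsum fun p => mul_le_mul_right ?_ _
            simp only [F]
            split_ifs
            · exact ENNReal.ofReal_le_ofReal (potential_le hn)
            · exact zero_le
        _ = _ := by rw [ENNReal.tsum_mul_right, PMF.tsum_coe, one_mul]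
    | succ j ih =>
      intro hj
      have hdiv : (i * τ + j) / τ = i := by
        rw [mul_comm, Nat.mul_add_div hτ, Nat.div_eq_of_lt hj, add_zero]
      calc _ ≤ ENNReal.ofReal (1 - β / 8) * ∑' p, P.chain k τ N (i * τ + j) p * F p :=
            hFstep _ hdiv
        _ ≤ ENNReal.ofReal (1 - β / 8) * (ENNReal.ofReal (1 - β / 8) ^ j *
              ENNReal.ofReal (Real.exp (k * Real.log (1 + n) / 2))) :=
            mul_le_mul_right (ih (by omega)) _
        _ = _ := by rw [pow_succ']; ring
  have hGF : ∀ p, G p ≤ ENNReal.ofReal (Real.exp (k / 2)) * F p := by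
    intro p
    simp only [G, F]
    split_ifs
    · rw [← ENNReal.ofReal_mul (Real.exp_pos _).le, ← ENNReal.ofReal_one]
      refine ENNReal.ofReal_le_ofReal ?_
      calc (1 : ℝ) = Real.exp (k / 2) * Real.exp (-(k / 2)) := by
            rw [← Real.exp_add, add_neg_cancel, Real.exp_zero]
        _ ≤ _ := mul_le_mul_of_nonneg_left p.2.le_potential (Real.exp_pos _).le
    · exact zero_le
  have hG0 : ∑' p, P.chain k τ N ((i + 1) * τ) p * G p ≤
      ENNReal.ofReal (Real.exp (k * (1 + Real.log (1 + n)) / 2 - β / 8 * τ)) := by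
    calc ∑' p, P.chain k τ N ((i + 1) * τ) p * G p
        ≤ ENNReal.ofReal (Real.exp (k / 2)) * ∑' p, P.chain k τ N (i * τ + τ) p * F p := by
          rw [← ENNReal.tsum_mul_left, add_mul, one_mul]
          refine ENNReal.tsum_le_tsum fun p => ?_
          rw [mul_left_comm]
          exact mul_le_mul_right (hGF p) _
      _ ≤ ENNReal.ofReal (Real.exp (k / 2)) * (ENNReal.ofReal (1 - β / 8) ^ τ *
            ENNReal.ofReal (Real.exp (k * Real.log (1 + n) / 2))) :=
          mul_le_mul_right (hF τ le_rfl) _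
      _ ≤ _ := by
          rw [← ENNReal.ofReal_pow hc0, ← ENNReal.ofReal_mul (by positivity),
            ← ENNReal.ofReal_mul (Real.exp_pos _).le]
          refine ENNReal.ofReal_le_ofReal ?_
          have h1 : (1 - β / 8) ^ τ ≤ Real.exp (-(β / 8 * τ)) := by
            calc (1 - β / 8) ^ τ ≤ Real.exp (-(β / 8)) ^ τ :=
                  pow_le_pow_left₀ hc0 (Real.one_sub_le_exp_neg _) _
              _ = _ := by rw [← Real.exp_nat_mul]; congr 1; ring
          calc Real.exp (k / 2) * ((1 - β / 8) ^ τ * Real.exp (k * Real.log (1 + n) / 2))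
              ≤ Real.exp (k / 2) * (Real.exp (-(β / 8 * τ)) *
                  Real.exp (k * Real.log (1 + n) / 2)) := by gcongr
            _ = _ := by
                rw [← Real.exp_add, ← Real.exp_add]
                congr 1
                ring
  have hG : ∀ j, ∑' p, P.chain k τ N ((i + 1) * τ + j) p * G p ≤
      ENNReal.ofReal (Real.exp (k * (1 + Real.log (1 + n)) / 2 - β / 8 * τ)) := by
    intro j
    induction j with
    | zero => exact hG0
    | succ j ih =>
      refine le_trans ?_ ih
      have hdiv : i ≤ ((i + 1) * τ + j) / τ := by
        rw [Nat.le_div_iff_mul_le hτ, add_mul, one_mul]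
        omega
      have := tsum_iterationLaw_succ_le (Ω := X ⊕ Y → Fin N)
        (next := fun t p ω => ⟨P.next k (2 ^ (t / τ)) p.1 (coins ω), p.2.next⟩)
        (s₀ := ⟨fun _ => none, valid_none⟩) (t := (i + 1) * τ + j) (F := G) (c := 1) (fun p => ?_)
      · rw [one_mul] at this
        exact this
      · rw [one_mul]
        by_cases hp : p ∈ P.crowded k (2 ^ i) β
        · calc _ ≤ ∑ ω : X ⊕ Y → Fin N, (1 : ℝ≥0∞) := by
                refine Finset.sum_le_sum fun ω _ => ?_
                simp only [G]
                split_ifs <;> simp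
            _ = _ := by simp [G, hp]
        · rw [Finset.sum_eq_zero]
          · exact zero_le
          · intro ω _
            exact if_neg fun h => hp (hmono p _ ω hdiv h)
  obtain ⟨j, rfl⟩ := Nat.exists_eq_add_of_le hT
  refine le_trans (le_of_eq ?_) (hG j)
  rw [PMF.toOuterMeasure_apply]
  refine tsum_congr fun p => ?_
  by_cases hp : p ∈ P.crowded k (2 ^ i) β <;> simp [G, hp]

end Preferences

/-! ### Counting blocking pairs -/

theorem sum_two_pow_filter_le {L d : ℕ} (hd : d < 2 ^ L) :
    d ≤ ∑ i ∈ (range L).filter (fun i => 2 ^ i ≤ d), 2 ^ i ∧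
      ∑ i ∈ (range L).filter (fun i => 2 ^ i ≤ d), 2 ^ i ≤ 2 * d := by
  have hgeom : ∀ m : ℕ, ∑ i ∈ range m, 2 ^ i + 1 = 2 ^ m := by
    intro m
    induction m with
    | zero => simp
    | succ m ih => rw [Finset.sum_range_succ, pow_succ]; omega
  rcases Nat.eq_zero_or_pos d with rfl | hpos
  · simp
  have hfilter : (range L).filter (fun i => 2 ^ i ≤ d) = range (Nat.log 2 d + 1) := by
    ext i
    rw [Finset.mem_filter, Finset.mem_range, Finset.mem_range, Nat.lt_succ_iff,
      Nat.le_log_iff_pow_le one_lt_two hpos.ne']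
    exact ⟨fun h => h.2, fun h => ⟨(Nat.pow_lt_pow_iff_right one_lt_two).1 (h.trans_lt hd), h⟩⟩
  rw [hfilter]
  have h1 := hgeom (Nat.log 2 d + 1)
  have h2 : d < 2 ^ (Nat.log 2 d + 1) := Nat.lt_pow_succ_log_self one_lt_two d
  have h3 : 2 ^ Nat.log 2 d ≤ d := Nat.pow_log_le_self 2 hpos.ne'
  rw [pow_succ] at h1 h2
  omega

theorem card_filter_mem_fst {α β : Type} [Fintype α] [Fintype β] [DecidableEq β]
    (s : α → Finset β) :
    (univ.filter fun e : α × β => e.2 ∈ s e.1).card = ∑ a, (s a).card := by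
  rw [Finset.card_filter, Fintype.sum_prod_type]
  simp

theorem card_filter_mem_snd {α β : Type} [Fintype α] [Fintype β] [DecidableEq α]
    (s : β → Finset α) :
    (univ.filter fun e : α × β => e.1 ∈ s e.2).card = ∑ b, (s b).card := by
  rw [Finset.card_filter, Fintype.sum_prod_type_right]
  simp

theorem Precedes.quantile_le {α : Type} [DecidableEq α] {k : ℕ} {l : List α} {a b : α}
    (hl : l.Nodup) (h : Precedes l a b) : quantile k l a ≤ quantile k l b := by
  obtain ⟨i, j, hij, hi, hj⟩ := h
  obtain ⟨hi', rfl⟩ := List.getElem?_eq_some_iff.1 hi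
  obtain ⟨hj', rfl⟩ := List.getElem?_eq_some_iff.1 hj
  refine Nat.div_le_div_right ?_
  rw [hl.idxOf_getElem, hl.idxOf_getElem]
  exact hij.le

namespace Preferences

variable {X Y : Type} {P : Preferences X Y}

theorem ncard_edges_eq_sum_man [Fintype X] [Fintype Y] :
    P.edges.ncard = ∑ m, (P.man m).length := by
  classical
  let s : Y → Finset X := fun m => (P.man m).toFinset
  have : P.edges = ↑(univ.filter fun e : Y × X => e.2 ∈ s e.1) := by
    ext e
    simp [s, edges, P.symm]
  rw [this, Set.ncard_coe_finset, card_filter_mem_fst]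
  exact Finset.sum_congr rfl fun m _ => List.toFinset_card_of_nodup (P.man_nodup m)

theorem ncard_edges_eq_sum_woman [Fintype X] [Fintype Y] :
    P.edges.ncard = ∑ w, (P.woman w).length := by
  classical
  let s : X → Finset Y := fun w => (P.woman w).toFinset
  have : P.edges = ↑(univ.filter fun e : Y × X => e.1 ∈ s e.2) := by
    ext e
    simp [s, edges, P.symm]
  rw [this, Set.ncard_coe_finset, card_filter_mem_snd]
  exact Finset.sum_congr rfl fun w _ => List.toFinset_card_of_nodup (P.woman_nodup w)

variable [DecidableEq X] [DecidableEq Y] {k : ℕ} {p : X → Option Y}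

theorem Valid.isMatching (hp : P.Valid k p) : P.IsMatching {e | p e.2 = some e.1} := by
  refine ⟨fun e he => ?_, ?_⟩
  · have := hp.mem _ _ he
    exact ⟨this, (P.symm _ _).1 this⟩
  · rintro ⟨m, w⟩ he ⟨m', w'⟩ hf h
    change p w = some m at he
    change p w' = some m' at hf
    rcases h with h | h
    · obtain rfl : m = m' := h
      rw [hp.inj w w' m he hf]
    · obtain rfl : w = w' := h
      rw [Option.some.inj (he.symm.trans hf)]

variable [Fintype X] [Fintype Y]

omit [DecidableEq X] in
/-- The acceptable partners of the unsettled men are counted degree class by degree class. -/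
theorem sum_length_unsettled_le {L : ℕ} (hL : ∀ m, (P.man m).length < 2 ^ L) {β : ℝ}
    (h : ∀ i < L, ((P.unsettled k (2 ^ i) p).card : ℝ) ≤ β * (P.busy (2 ^ i)).card)
    (hβ : 0 ≤ β) :
    ∑ m ∈ P.unsettled k 1 p, ((P.man m).length : ℝ) ≤ 2 * β * P.edges.ncard := by
  classical
  have hU : ∀ i, P.unsettled k (2 ^ i) p =
      (P.unsettled k 1 p).filter fun m => 2 ^ i ≤ (P.man m).length := by
    intro i
    ext m
    rw [Finset.mem_filter, mem_unsettled, mem_unsettled]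
    constructor
    · rintro ⟨h1, h2⟩
      exact ⟨⟨(Nat.one_le_two_pow).trans h1, h2⟩, h1⟩
    · rintro ⟨⟨-, h2⟩, h1⟩
      exact ⟨h1, h2⟩
  have hswap : ∀ S : Finset Y, ∑ m ∈ S, ∑ i ∈ (range L).filter
      (fun i => 2 ^ i ≤ (P.man m).length), (2 : ℝ) ^ i =
      ∑ i ∈ range L, 2 ^ i * ((S.filter fun m => 2 ^ i ≤ (P.man m).length).card : ℝ) := by
    intro S
    simp only [Finset.sum_filter]
    rw [Finset.sum_comm]
    refine Finset.sum_congr rfl fun i _ => ?_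
    rw [← Finset.sum_filter, Finset.sum_const, nsmul_eq_mul, mul_comm]
  calc ∑ m ∈ P.unsettled k 1 p, ((P.man m).length : ℝ)
      ≤ ∑ m ∈ P.unsettled k 1 p, ∑ i ∈ (range L).filter
          (fun i => 2 ^ i ≤ (P.man m).length), (2 : ℝ) ^ i :=
        Finset.sum_le_sum fun m _ => by exact_mod_cast (sum_two_pow_filter_le (hL m)).1
    _ = ∑ i ∈ range L, 2 ^ i * ((P.unsettled k (2 ^ i) p).card : ℝ) := by
        rw [hswap]
        exact Finset.sum_congr rfl fun i _ => by rw [hU]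
    _ ≤ ∑ i ∈ range L, 2 ^ i * (β * (P.busy (2 ^ i)).card) :=
        Finset.sum_le_sum fun i hi =>
          mul_le_mul_of_nonneg_left (h i (Finset.mem_range.1 hi)) (by positivity)
    _ = β * ∑ m : Y, ∑ i ∈ (range L).filter
          (fun i => 2 ^ i ≤ (P.man m).length), (2 : ℝ) ^ i := by
        rw [hswap, Finset.mul_sum]
        exact Finset.sum_congr rfl fun i _ => by rw [busy]; ring
    _ ≤ β * ∑ m : Y, 2 * ((P.man m).length : ℝ) := by
        refine mul_le_mul_of_nonneg_left (Finset.sum_le_sum fun m _ => ?_) hβ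
        exact_mod_cast (sum_two_pow_filter_le (hL m)).2
    _ = 2 * β * P.edges.ncard := by
        rw [← Finset.mul_sum, ncard_edges_eq_sum_man]
        push_cast
        ring

/-- A blocking pair involves an unsettled man, or a player who is matched to a different member
of the quantile that holds the other one. -/
theorem Valid.ncard_blockingPairs_le (hp : P.Valid k p) :
    ((P.blockingPairs {e | p e.2 = some e.1}).ncard : ℝ) ≤
      ∑ m ∈ P.unsettled k 1 p, ((P.man m).length : ℝ) + 2 * (P.edges.ncard / k) := by
  classical
  -- The three kinds of pairs: those of unsettled men, and those at the members of a quantile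
  -- that holds the partner of the man or of the woman.
  let mates : (m : Y) → X → Finset X := fun m w =>
    ((P.man m).toFinset.filter fun x =>
      quantile k (P.man m) x = quantile k (P.man m) w).erase w
  let s₁ : Y → Finset X := fun m => if m ∈ P.unsettled k 1 p then (P.man m).toFinset else ∅
  let s₂ : Y → Finset X := fun m =>
    if h : ∃ w, p w = some m then mates m h.choose else ∅
  let s₃ : X → Finset Y := fun w =>
    match p w with
    | some m => ((P.woman w).toFinset.filter fun y =>
        quantile k (P.woman w) y = quantile k (P.woman w) m).erase m
    | none => ∅
  have hsub : P.blockingPairs {e | p e.2 = some e.1} ⊆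
      ↑((univ.filter fun e : Y × X => e.2 ∈ s₁ e.1) ∪ (univ.filter fun e : Y × X => e.2 ∈ s₂ e.1)
        ∪ (univ.filter fun e : Y × X => e.1 ∈ s₃ e.2)) := by
    rintro ⟨m, w⟩ ⟨⟨hmw, hwm⟩, hne, hwoman, hman⟩
    simp only [Set.mem_ofPred_eq] at hmw hwm hne hwoman hman
    simp only [Finset.coe_union, Finset.coe_filter, Finset.mem_univ, true_and, Set.mem_union,
      Set.mem_ofPred_eq]
    by_cases hl : P.Live k p m w
    -- If `w` still accepts `m`, then either `m` is single, or his partner shares her quantile;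
    -- otherwise she rejected him for a man of his quantile.
    · left
      by_cases hx : ∃ x, p x = some m
      · right
        have hx' := hx.choose_spec
        have h1 := hp.cleared _ m hx' w hwm
        have h2 := (hman _ hx').quantile_le (k := k) (P.man_nodup m)
        have h3 : w ≠ hx.choose := by
          intro h
          rw [← h] at hx'
          exact hne hx'
        simp only [s₂, dif_pos hx, mates, Finset.mem_erase, Finset.mem_filter, List.mem_toFinset]
        exact ⟨h3, hwm, le_antisymm h2 (not_lt.1 fun h => h1 h hl)⟩
      · left
        have : m ∈ P.unsettled k 1 p :=
          mem_unsettled.2 ⟨List.length_pos_of_mem hwm, not_exists.1 hx, w, hwm, hl⟩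
        simp only [s₁, if_pos this, List.mem_toFinset]
        exact hwm
    · right
      simp only [Live, Acceptable, not_forall, not_or] at hl
      obtain ⟨y, hy, hmy, hq⟩ := hl
      have h2 := (hwoman y hy).quantile_le (k := k) (P.woman_nodup w)
      simp only [s₃, hy, Finset.mem_erase, Finset.mem_filter, List.mem_toFinset]
      exact ⟨hmy, hmw, le_antisymm h2 (not_lt.1 hq)⟩
  have hcard := Set.ncard_le_ncard hsub (Finset.finite_toSet _)
  rw [Set.ncard_coe_finset] at hcard
  have hcard' := (hcard.trans (Finset.card_union_le _ _)).trans
    (Nat.add_le_add_right (Finset.card_union_le _ _) _)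
  rw [card_filter_mem_fst, card_filter_mem_fst, card_filter_mem_snd] at hcard'
  have hreal : ((P.blockingPairs {e | p e.2 = some e.1}).ncard : ℝ) ≤
      ∑ m, ((s₁ m).card : ℝ) + ∑ m, ((s₂ m).card : ℝ) + ∑ w, ((s₃ w).card : ℝ) := by
    exact_mod_cast hcard'
  have h1 : ∑ m, ((s₁ m).card : ℝ) = ∑ m ∈ P.unsettled k 1 p, ((P.man m).length : ℝ) := by
    rw [← Finset.sum_subset (Finset.subset_univ (P.unsettled k 1 p))]
    · refine Finset.sum_congr rfl fun m hm => ?_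
      simp only [s₁, if_pos hm]
      rw [List.toFinset_card_of_nodup (P.man_nodup m)]
    · intro m _ hm
      simp [s₁, hm]
  have h2 : ∑ m, ((s₂ m).card : ℝ) ≤ P.edges.ncard / k := by
    rw [ncard_edges_eq_sum_man, Nat.cast_sum, Finset.sum_div]
    refine Finset.sum_le_sum fun m _ => ?_
    simp only [s₂]
    split_ifs with h
    · exact card_quantile_eq_le ((P.symm _ _).1 (hp.mem _ _ h.choose_spec))
    · simp only [Finset.card_empty, Nat.cast_zero]
      positivity
  have h3 : ∑ w, ((s₃ w).card : ℝ) ≤ P.edges.ncard / k := by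
    rw [ncard_edges_eq_sum_woman, Nat.cast_sum, Finset.sum_div]
    refine Finset.sum_le_sum fun w _ => ?_
    cases hw : p w with
    | some m =>
      simp only [s₃, hw]
      exact card_quantile_eq_le (hp.mem _ _ hw)
    | none =>
      simp only [s₃, hw, Finset.card_empty, Nat.cast_zero]
      positivity
  linarith

theorem Valid.isAlmostStable (hp : P.Valid k p) {L : ℕ} (hL : ∀ m, (P.man m).length < 2 ^ L)
    {ε : ℝ} (hε : 0 < ε) (hk : 4 / ε ≤ k)
    (h : ∀ i < L, ((P.unsettled k (2 ^ i) p).card : ℝ) ≤ ε / 4 * (P.busy (2 ^ i)).card) :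
    P.IsAlmostStable ε {e | p e.2 = some e.1} := by
  refine ⟨hp.isMatching, hp.ncard_blockingPairs_le.trans ?_⟩
  have h1 := sum_length_unsettled_le hL h (by positivity)
  have hkpos : (0 : ℝ) < k := (by positivity : (0 : ℝ) < 4 / ε).trans_le hk
  have h2 : (P.edges.ncard : ℝ) / k ≤ ε / 4 * P.edges.ncard := by
    rw [div_le_iff₀ hkpos]
    rw [div_le_iff₀ hε] at hk
    have : (0 : ℝ) ≤ P.edges.ncard := Nat.cast_nonneg _
    nlinarith
  linarith

omit [Fintype X] [Fintype Y] in
theorem Valid.represents_outputs (hp : P.Valid k p) (uid : X ⊕ Y → ℕ) :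
    Represents uid (P.outputs uid p) {e | p e.2 = some e.1} := by
  constructor
  · intro x i
    simp [outputs, Option.map_eq_some_iff]
  · intro y i
    simp only [outputs, Option.map_eq_some_iff, Set.mem_ofPred_eq]
    constructor
    · rintro ⟨x, hx, rfl⟩
      exact ⟨x, by simpa using List.find?_some hx, rfl⟩
    · rintro ⟨x, hx, rfl⟩
      refine ⟨x, ?_, rfl⟩
      rw [find?_eq_some_iff_idxOf]
      refine ⟨by simpa using hx, (P.symm _ _).1 (hp.mem _ _ hx), fun b _ hb => ?_⟩
      rw [hp.inj x b y hx (by simpa using hb)]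

/-! ### Success of the algorithm -/

/-- If the stages are long enough, the outputs form an almost stable matching with high
probability. -/
theorem le_outputLaw_randASM {n k τ L : ℕ} {ε δ : ℝ} {uid : X ⊕ Y → ℕ}
    (hu : Function.Injective uid) [NeZero n.factorial] (hn : ∀ m, (P.man m).length ≤ n)
    (hε : 0 < ε) (hε1 : ε < 1) (hδ : 0 < δ) (hk : 4 / ε ≤ k) (hL : n < 2 ^ L)
    (hτ : L * Real.exp (k * (1 + Real.log (1 + n)) / 2 - ε / 4 / 8 * τ) ≤ δ) (hτ0 : 0 < τ) :
    ENNReal.ofReal (1 - δ) ≤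
      ((randASM k τ (L * τ) n.factorial).outputLaw P.commGraph uid
        (P.playerInput uid)).toOuterMeasure
          {out | ∃ M, P.IsAlmostStable ε M ∧ Represents uid out M} := by
  rw [outputLaw_randASM hu, PMF.toOuterMeasure_map_apply]
  set μ := P.chain k τ n.factorial (L * τ) with hμ
  have hkpos : 0 < k := Nat.cast_pos.1 ((by positivity : (0 : ℝ) < 4 / ε).trans_le hk)
  set good : Set {p : X → Option Y // P.Valid k p} := (fun p => P.outputs uid p.1) ⁻¹'
    {out | ∃ M, P.IsAlmostStable ε M ∧ Represents uid out M} with hgood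
  set bad : Set {p : X → Option Y // P.Valid k p} :=
    ⋃ i ∈ range L, P.crowded k (2 ^ i) (ε / 4) with hbad
  have hcover : Set.univ ⊆ good ∪ bad := by
    intro p _
    by_cases hp : p ∈ bad
    · exact Or.inr hp
    · left
      refine ⟨_, p.2.isAlmostStable (fun m => (hn m).trans_lt hL) hε hk fun i hi => ?_,
        p.2.represents_outputs uid⟩
      simp only [hbad, Set.mem_iUnion, not_exists, Finset.mem_range] at hp
      exact not_lt.1 (hp i hi)
  have hbadle : μ.toOuterMeasure bad ≤ ENNReal.ofReal δ := by
    calc μ.toOuterMeasure bad ≤ ∑ i ∈ range L, μ.toOuterMeasure (P.crowded k (2 ^ i) (ε / 4)) :=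
          MeasureTheory.measure_biUnion_finset_le _ _
      _ ≤ ∑ i ∈ range L, ENNReal.ofReal
            (Real.exp (k * (1 + Real.log (1 + n)) / 2 - ε / 4 / 8 * τ)) := by
          refine Finset.sum_le_sum fun i hi => ?_
          refine chain_crowded_le hn (fun m d h0 hd => Nat.dvd_factorial h0 (hd.trans (hn m)))
            hkpos hτ0 (by linarith) (Nat.mul_le_mul_right _ (Finset.mem_range.1 hi))
      _ = ENNReal.ofReal (L * Real.exp (k * (1 + Real.log (1 + n)) / 2 - ε / 4 / 8 * τ)) := by
          rw [Finset.sum_const, Finset.card_range, nsmul_eq_mul,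
            ENNReal.ofReal_mul (Nat.cast_nonneg _), ENNReal.ofReal_natCast]
      _ ≤ ENNReal.ofReal δ := ENNReal.ofReal_le_ofReal hτ
  have hone : (1 : ℝ≥0∞) ≤ μ.toOuterMeasure good + ENNReal.ofReal δ := by
    calc (1 : ℝ≥0∞) = μ.toOuterMeasure Set.univ :=
          ((PMF.toOuterMeasure_apply_eq_one_iff _ _).2 (Set.subset_univ _)).symm
      _ ≤ μ.toOuterMeasure (good ∪ bad) := μ.toOuterMeasure.mono hcover
      _ ≤ μ.toOuterMeasure good + μ.toOuterMeasure bad := MeasureTheory.measure_union_le _ _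
      _ ≤ _ := by gcongr
  rw [ENNReal.ofReal_sub _ hδ.le, ENNReal.ofReal_one]
  exact tsub_le_iff_right.2 hone

end Preferences

/-! ### Instances that need no communication -/

/-- The algorithm without communication whose outputs are given by `f`. -/
def localAlgorithm (f : PlayerInput → Option ℕ) : DistributedAlgorithm PlayerInput (Option ℕ) where
  State := Option ℕ
  Coin := Unit
  rounds := 0
  init := f
  step s _ _ := (s, fun _ => none)
  output s := s

section Local

variable {V : Type} [Fintype V] [DecidableEq V] {G : SimpleGraph V} {uid : V → ℕ}
  {input : V → PlayerInput} {f : PlayerInput → Option ℕ}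

theorem localAlgorithm_messagesAtMost {b : ℝ} :
    (localAlgorithm f).MessagesAtMost G uid input b := by
  intro t ht c hc u v _ m hm
  obtain rfl : t = 0 := Nat.le_zero.1 ht
  rw [DistributedAlgorithm.law, PMF.mem_support_pure_iff] at hc
  subst hc
  simp [DistributedAlgorithm.initConfig] at hm

theorem outputLaw_localAlgorithm :
    (localAlgorithm f).outputLaw G uid input = PMF.pure fun v => f (input v) := by
  have h : (localAlgorithm f).rounds = 0 := rfl
  rw [DistributedAlgorithm.outputLaw, h, DistributedAlgorithm.law, PMF.pure_map]
  rfl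

end Local

namespace Preferences

variable {X Y : Type} {P : Preferences X Y}

/-- With one player on each side, all mutually acceptable pairs can be matched. -/
theorem isAlmostStable_edges [Subsingleton X] [Subsingleton Y] {ε : ℝ} (hε : 0 ≤ ε) :
    P.IsAlmostStable ε P.edges := by
  refine ⟨⟨subset_rfl, fun e _ f _ _ => Subsingleton.elim e f⟩, ?_⟩
  have : P.blockingPairs P.edges = ∅ := by
    ext e
    simp only [blockingPairs, Set.mem_ofPred_eq, Set.mem_empty_iff_false, iff_false]
    exact fun h => h.2.1 h.1
  rw [this]
  simp only [Set.ncard_empty, Nat.cast_zero]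
  positivity

theorem represents_head? [Subsingleton X] [Subsingleton Y] (uid : X ⊕ Y → ℕ) :
    Represents uid (fun v => (P.playerInput uid v).prefs.head?) P.edges := by
  have head : ∀ {α : Type} [Subsingleton α] (l : List α) (a : α), l.head? = some a ↔ a ∈ l := by
    intro α _ l a
    cases l with
    | nil => simp
    | cons b l => simp [Subsingleton.elim a b]
  constructor
  · intro x i
    simp [playerInput, List.head?_map, head, edges, P.symm]
  · intro y i
    simp [playerInput, List.head?_map, head, edges, P.symm]

theorem isAlmostStable_empty [Finite X] [Finite Y] {ε : ℝ} (hε : 1 ≤ ε) :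
    P.IsAlmostStable ε ∅ := by
  refine ⟨⟨Set.empty_subset _, fun e he => absurd he (Set.notMem_empty e)⟩, ?_⟩
  have h : (P.blockingPairs ∅).ncard ≤ P.edges.ncard :=
    Set.ncard_le_ncard (fun e he => he.1) (Set.toFinite _)
  have h' : ((P.blockingPairs ∅).ncard : ℝ) ≤ P.edges.ncard := Nat.cast_le.2 h
  have : (0 : ℝ) ≤ P.edges.ncard := Nat.cast_nonneg _
  nlinarith

end Preferences

/-! ### Choice of the parameters -/

/-- The number of quantiles for a given `ε`. -/
noncomputable def numQuantiles (ε : ℝ) : ℕ := ⌈4 / ε⌉₊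

/-- The number of degree classes. -/
def numStages (n : ℕ) : ℕ := Nat.log 2 n + 1

/-- The number of steps for each degree class. -/
noncomputable def stageLength (n : ℕ) (ε δ : ℝ) : ℕ :=
  ⌈32 / ε * (numQuantiles ε * (1 + Real.log (1 + n)) / 2 + Real.log (n / δ))⌉₊

theorem numStages_le {n : ℕ} (hn : 2 ≤ n) : numStages n ≤ n :=
  Nat.log_lt_self 2 (by omega)

/-- A union bound over the stages leaves a failure probability of at most `δ`. -/
theorem stageLength_spec {n : ℕ} {ε δ : ℝ} (hn : 2 ≤ n) (hε : 0 < ε) (hδ : 0 < δ) :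
    numStages n * Real.exp (numQuantiles ε * (1 + Real.log (1 + n)) / 2 -
      ε / 4 / 8 * stageLength n ε δ) ≤ δ := by
  have hn' : (0 : ℝ) < n := by positivity
  have h1 : 32 / ε * (numQuantiles ε * (1 + Real.log (1 + n)) / 2 + Real.log (n / δ)) ≤
      stageLength n ε δ := Nat.le_ceil _
  have h2 := mul_le_mul_of_nonneg_left h1 (show 0 ≤ ε / 4 / 8 by positivity)
  have h3 : ε / 4 / 8 * (32 / ε * (numQuantiles ε * (1 + Real.log (1 + n)) / 2 +
      Real.log (n / δ))) = numQuantiles ε * (1 + Real.log (1 + n)) / 2 + Real.log (n / δ) := by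
    field_simp
    ring
  calc numStages n * Real.exp (numQuantiles ε * (1 + Real.log (1 + n)) / 2 -
        ε / 4 / 8 * stageLength n ε δ)
      ≤ n * Real.exp (-Real.log (n / δ)) := by
        refine mul_le_mul (Nat.cast_le.2 (numStages_le hn)) (Real.exp_le_exp.2 ?_)
          (Real.exp_pos _).le hn'.le
        linarith
    _ = δ := by
        rw [Real.exp_neg, Real.exp_log (by positivity)]
        field_simp

theorem rounds_le {n : ℕ} {ε δ : ℝ} (hn : 2 ≤ n) (hε : 0 < ε) (hε1 : ε < 1) (hδ : 0 < δ)
    (hδ1 : δ < 1) :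
    ((2 * (numStages n * stageLength n ε δ) + 2 : ℕ) : ℝ) ≤
      2840 * ((ε ^ 3)⁻¹ * Real.log (n / (δ * ε ^ 3)) ^ 2) := by
  have hn2 : (2 : ℝ) ≤ n := by exact_mod_cast hn
  have hn' : (0 : ℝ) < n := by linarith
  set Λ := Real.log (n / (δ * ε ^ 3)) with hΛ
  have hε3 : ε ^ 3 ≤ 1 := pow_le_one₀ hε.le hε1.le
  have hnδ : Real.log (n / δ) ≤ Λ := by
    refine Real.log_le_log (by positivity) ?_
    refine div_le_div_of_nonneg_left hn'.le (by positivity) ?_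
    nlinarith
  have hlogn : Real.log n ≤ Real.log (n / δ) := by
    refine Real.log_le_log hn' ?_
    rw [le_div_iff₀ hδ]
    nlinarith
  -- As `n ≥ 2`, additive constants are absorbed by multiples of `Λ ≥ 1 / 2`.
  have hlog2 : Real.log 2 ≤ Real.log n := Real.log_le_log two_pos hn2
  have hhalf : 1 / 2 < Real.log 2 := by
    have := Real.log_two_gt_d9
    linarith
  have hΛhalf : 1 / 2 ≤ Λ := by linarith
  have hinv : 1 ≤ 1 / ε := by rw [le_div_iff₀ hε]; linarith
  have hk : (numQuantiles ε : ℝ) ≤ 5 * (1 / ε) := by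
    have := (Nat.ceil_lt_add_one (show 0 ≤ 4 / ε by positivity)).le
    have h4 : 4 / ε = 4 * (1 / ε) := by ring
    unfold numQuantiles
    linarith
  have hlog1n : 1 + Real.log (1 + n) ≤ 4 * Λ := by
    have : Real.log (1 + n) ≤ Real.log (2 * n) := Real.log_le_log (by positivity) (by linarith)
    rw [Real.log_mul two_ne_zero hn'.ne'] at this
    linarith
  have hlogpos : 0 ≤ 1 + Real.log (1 + n) := by
    have : 0 ≤ Real.log (1 + (n : ℝ)) := Real.log_nonneg (by linarith)
    linarith
  have hL : (numStages n : ℝ) ≤ 4 * Λ := by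
    have h1 : (Nat.log 2 n : ℝ) * Real.log 2 ≤ Real.log n := by
      rw [← Real.log_pow]
      refine Real.log_le_log (by positivity) ?_
      exact_mod_cast Nat.pow_log_le_self 2 (by omega)
    unfold numStages
    push_cast
    have h0 : (0 : ℝ) ≤ Nat.log 2 n := Nat.cast_nonneg _
    nlinarith
  have hτ : (stageLength n ε δ : ℝ) ≤ 354 * Λ * (1 / ε) ^ 2 := by
    have hK : numQuantiles ε * (1 + Real.log (1 + n)) / 2 ≤ 10 * Λ * (1 / ε) := by
      have := mul_le_mul hk hlog1n hlogpos (by positivity)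
      linarith
    have hsum : numQuantiles ε * (1 + Real.log (1 + n)) / 2 + Real.log (n / δ) ≤
        11 * Λ * (1 / ε) := by nlinarith
    have hnn : 0 ≤ 32 / ε * (numQuantiles ε * (1 + Real.log (1 + n)) / 2 + Real.log (n / δ)) := by
      have : 0 ≤ Real.log (n / δ) := by linarith
      positivity
    have hceil := (Nat.ceil_lt_add_one hnn).le
    have hmul := mul_le_mul_of_nonneg_left hsum (show 0 ≤ 32 / ε by positivity)
    have hone : 1 ≤ 2 * Λ * (1 / ε) ^ 2 := by
      have : 1 ≤ (1 / ε) ^ 2 := one_le_pow₀ hinv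
      nlinarith
    have e : 32 / ε * (11 * Λ * (1 / ε)) = 352 * Λ * (1 / ε) ^ 2 := by ring
    unfold stageLength
    linarith
  have hprod : (numStages n : ℝ) * stageLength n ε δ ≤ 4 * Λ * (354 * Λ * (1 / ε) ^ 2) :=
    mul_le_mul hL hτ (Nat.cast_nonneg _) (by linarith)
  have htwo : 2 ≤ 8 * Λ ^ 2 * (1 / ε) ^ 2 := by
    have h1 : 1 ≤ (1 / ε) ^ 2 := one_le_pow₀ hinv
    have h2 : 1 / 4 ≤ Λ ^ 2 := by nlinarith
    nlinarith
  have hcube : (1 / ε) ^ 2 ≤ (ε ^ 3)⁻¹ := by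
    have : (ε ^ 3)⁻¹ = (1 / ε) ^ 2 * (1 / ε) := by field_simp
    rw [this]
    exact le_mul_of_one_le_right (by positivity) hinv
  push_cast
  calc 2 * ((numStages n : ℝ) * stageLength n ε δ) + 2
      ≤ 2840 * ((1 / ε) ^ 2 * Λ ^ 2) := by nlinarith
    _ ≤ 2840 * ((ε ^ 3)⁻¹ * Λ ^ 2) := by gcongr

end AlmostStable

open AlmostStable in
theorem mainTheorem3 :
    ∃ (RandASM : ℕ → ℝ → ℝ → DistributedAlgorithm PlayerInput (Option ℕ)) (B C : ℝ),
      ∀ (n : ℕ) (ε δ : ℝ), 0 < n → 0 < ε → 0 < δ →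
        ((RandASM n ε δ).rounds : ℝ) ≤ C * ((ε ^ 3)⁻¹ * Real.log (n / (δ * ε ^ 3)) ^ 2) ∧
        ∀ (X Y : Type) [Fintype X] [Fintype Y] [DecidableEq X] [DecidableEq Y],
          Fintype.card X = n → Fintype.card Y = n →
          ∀ (P : Preferences X Y) (uid : X ⊕ Y → ℕ), Function.Injective uid →
            (RandASM n ε δ).MessagesAtMost P.commGraph uid (P.playerInput uid)
              (B * Real.log n) ∧
            ENNReal.ofReal (1 - δ) ≤
              ((RandASM n ε δ).outputLaw P.commGraph uid (P.playerInput uid)).toOuterMeasure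
                {out | ∃ M, P.IsAlmostStable ε M ∧ Represents uid out M} := by
  classical
  have hfact : ∀ n : ℕ, NeZero n.factorial := fun n => ⟨n.factorial_ne_zero⟩
  -- `n!` is divisible by all numbers of choices that can occur. For `n = 1` each player takes
  -- the only candidate; otherwise, if `ε ≥ 1` or `δ ≥ 1`, the empty matching is good enough.
  refine ⟨fun n ε δ => if 2 ≤ n ∧ ε < 1 ∧ δ < 1 then
      randASM (numQuantiles ε) (stageLength n ε δ) (numStages n * stageLength n ε δ) n.factorial
    else localAlgorithm fun i => if n = 1 then i.prefs.head? else none, 2, 2840, ?_⟩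
  intro n ε δ hn hε hδ
  by_cases h : 2 ≤ n ∧ ε < 1 ∧ δ < 1
  · obtain ⟨hn2, hε1, hδ1⟩ := h
    simp only [if_pos (And.intro hn2 (And.intro hε1 hδ1))]
    refine ⟨rounds_le hn2 hε hε1 hδ hδ1, ?_⟩
    intro X Y _ _ _ _ hX hY P uid hu
    have hlen : ∀ m, (P.man m).length ≤ n := fun m => hX ▸ (P.man_nodup m).length_le_card
    refine ⟨randASM_messagesAtMost ?_, ?_⟩
    · have h1 : Real.log 2 ≤ Real.log n :=
        Real.log_le_log two_pos (by exact_mod_cast hn2)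
      have h2 := Real.log_two_gt_d9
      linarith
    · refine Preferences.le_outputLaw_randASM hu hlen hε hε1 hδ (Nat.le_ceil _)
        (Nat.lt_pow_succ_log_self one_lt_two n) (stageLength_spec hn2 hε hδ) ?_
      refine Nat.ceil_pos.2 ?_
      have hlog : 0 ≤ Real.log (1 + (n : ℝ)) := Real.log_nonneg (by simp)
      have hlog' : 0 < Real.log (n / δ) := by
        refine Real.log_pos ?_
        rw [lt_div_iff₀ hδ]
        have : (2 : ℝ) ≤ n := by exact_mod_cast hn2
        linarith
      positivity
  · simp only [if_neg h]
    refine ⟨?_, ?_⟩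
    · change ((0 : ℕ) : ℝ) ≤ _
      rw [Nat.cast_zero]
      positivity
    intro X Y _ _ _ _ hX hY P uid hu
    refine ⟨localAlgorithm_messagesAtMost, ?_⟩
    rw [outputLaw_localAlgorithm]
    rcases le_or_gt 1 δ with hδ1 | hδ1
    · rw [ENNReal.ofReal_of_nonpos (by linarith)]
      exact zero_le
    refine (ENNReal.ofReal_le_one.2 (by linarith)).trans (le_of_eq ?_)
    symm
    rw [PMF.toOuterMeasure_apply_eq_one_iff, PMF.support_pure, Set.singleton_subset_iff]
    by_cases hn1 : n = 1
    · subst hn1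
      have : Subsingleton X := Fintype.card_le_one_iff_subsingleton.1 hX.le
      have : Subsingleton Y := Fintype.card_le_one_iff_subsingleton.1 hY.le
      refine ⟨P.edges, P.isAlmostStable_edges hε.le, ?_⟩
      simpa using P.represents_head? uid
    · have hε1 : 1 ≤ ε := by
        by_contra hlt
        exact h ⟨by omega, not_le.1 hlt, hδ1⟩
      refine ⟨∅, P.isAlmostStable_empty hε1, ?_⟩
      simp [hn1, Represents]
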